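/- **Setting.** Let $X$ (the space of lightrays) be a locally compact, second countable Hausdorff space with a Borel measure $\mu=d^2x$ finite on compact sets. On the null hypersurface $\mathbb R\times X\ni(u,x)$, split at $u=0$, a real scalar field (rescaled by the area density) has the commutator $[\hat\phi(u,x),\hat\phi(u',x')]=\tfrac i4\,\delta(x,x')\,\mathrm{sign}(u'-u)$. So the smeared fields $\hat\phi(f)=\int d^2x\,du\,f\hat\phi$ satisfy $[\hat\phi(f),\hat\phi(g)]=i\sigma(f,g)$ with $\sigma(f,g)=\frac14\int_X d\mu(x)\iint du\,du'\,f(u,x)g(u',x)\,\mathrm{sign}(u'-u)$. Zero modes are neglected: test functions $f$ for the half-horizon are continuous, compactly supported, vanish for $u\le 0$ and satisfy $\int f(u,x)\,du=0$ for every $x$. Let $(a_k,b_k)_{k\in I}$ be any finite or infinite family of such test functions with $\sigma(a_j,b_k)=\delta_{jk}$, $\sigma(a_j,a_k)=\sigma(b_j,b_k)=0$, so that $A_k=\phi(a_k)$, $B_k=\phi(b_k)$ are canonical coordinates of the phase space of the fields at $u>0$. The $u$-odd components $\phi_-(u,x)=\frac12(\phi(u,x)-\phi(-u,x))$, $u>0$,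 commute. A wavefunctional $\Psi[\phi_-]$ is a functional of the real numbers $\phi_-(a_k),\phi_-(b_k)$ that is square-integrable for the flat measure $\mathcal D\phi_-$. As this measure has no meaning for infinitely many modes, we write $\Psi=F\,\Omega$, $\Omega=\prod_k\sqrt{2/\pi}\,e^{-\phi_-(a_k)^2-\phi_-(b_k)^2}$, with $F\in L^2(\gamma)$, where $\gamma=\Omega^2\mathcal D\phi_-$ is the product of centred Gaussian measures of variance $1/4$. (For finitely many modes this is no restriction on $\Psi\in L^2$.) On these wavefunctionals $\hat\phi_-(f)$ acts by multiplication, and the conjugate $u$-even fields act as the derivatives determined by the commutator. The half-horizon's Hilbert space $K$ consists, in the same way, of the wavefunctionals of the $B_k$, written relative to $\prod_k\pi^{-1/4}e^{-B_k^2/2}$; there $\hat B_k$ acts by multiplication and $\hat A_k=i\,\partial/\partial B_k$. **Theorem.** Let $\Psi[\phi_-]$, $\|\Psi\|=1$, be a pure state on the horizon. 1. Substituting $\phi_-(u,x)\to\phi(u,x)$ for $u>0$, regard $\Psi$ as a functional $\Psi[A,B]$ on the half-horizon's phase space. 2. This functional has a Wigner–Weyl transform: there is exactly one bounded operator $\hat\Psi$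 on $K$ with kernel $$\tilde\Psi[B_1,B_2]=\int\mathcal DA\;e^{iA\cdot(B_2-B_1)}\,\Psi\!\left[A,\tfrac12(B_1+B_2)\right],\qquad \mathcal DA=\prod_k\frac{dA_k}{\sqrt{2\pi}},$$ in the sense that $\langle g,\hat\Psi h\rangle=\int\mathcal DA\,\mathcal DB\,\Psi[A,B]\,W_{g,h}[A,B]$ with $\mathcal DA\,\mathcal DB=\prod_k dA_k\,dB_k$ flat and $W_{g,h}[A,B]=\int\prod_k\frac{d\lambda_k}{\sqrt{2\pi}}\,e^{iA\cdot\lambda}\,\overline{g(B-\lambda/2)}\,h(B+\lambda/2)$, for all $g,h$ that are continuous and compactly supported in finitely many of the $B_k$ and equal to the reference Gaussian in the others. 3. The density operator of the state restricted to the half-horizon $u>0$ is $\hat\rho=\hat\Psi\hat\Psi^\dagger$. That is, $\hat\rho$ is positive, has trace one, and satisfies $$\mathrm{Tr}\big(\hat\rho\,e^{i\hat\phi(f)}\big)=\langle\Psi|e^{i\hat\phi(f)}|\Psi\rangle$$ for every finite linear combination $f$ of the $a_k,b_k$, where $e^{i\hat\phi(f)}$ acts on $K$ on the left and on the wavefunctionals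 $\Psi[\phi_-]$ on the right; and it is the only operator on $K$ with these properties. -/

import Mathlib

open MeasureTheory ProbabilityTheory
open scoped NNReal

noncomputable section

namespace Horizon

/-! ### Kinematics of a scalar field on a null hypersurface

The hypersurface is `ℝ × X`: `u : ℝ` is the null coordinate, `x : X` labels the lightrays and `μ` is
the transverse measure `d²x`. Real test functions on it smear the (area-rescaled) field,
`φ(f) = ∫ d²x du f(u,x) φ(u,x)`. -/

section Kinematics

variable {X : Type*}

/-- The commutator form `σ` of the smeared fields, `[φ(f), φ(g)] = i σ(f, g)`, for the local commutator
`[φ(u,x), φ(u',x')] = (i/4) δ(x,x') sign(u' - u)`. -/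
def commForm [MeasurableSpace X] (μ : Measure X) (f g : ℝ × X → ℝ) : ℝ :=
  (1 / 4) * ∫ x, (∫ u : ℝ, (∫ u' : ℝ, f (u, x) * g (u', x) * Real.sign (u' - u))) ∂μ

/-- The reflection `u ↦ -u` on test functions, so that `φ(reflect f) = ∫ f(u,x) φ(-u,x)`. -/
def reflect (f : ℝ × X → ℝ) : ℝ × X → ℝ := fun p => f (-p.1, p.2)

/-- The `u`-odd part of a test function. For `f` supported in `u > 0`, smearing `φ` with `oddPart f` is
smearing the `u`-odd component `φ₋(u,x) = (φ(u,x) - φ(-u,x)) / 2` with `f`. -/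
def oddPart (f : ℝ × X → ℝ) : ℝ × X → ℝ := fun p => (f p - reflect f p) / 2

/-- The `u`-even part of a test function; it smears `φ₊(u,x) = (φ(u,x) + φ(-u,x)) / 2`. -/
def evenPart (f : ℝ × X → ℝ) : ℝ × X → ℝ := fun p => (f p + reflect f p) / 2

/-- Test functions for the half-horizon `u > 0`: continuous, compactly supported, vanishing for
`u ≤ 0`, and blind to the zero modes (no response to a `u`-independent shift of the field). -/
structure IsHalfTest [TopologicalSpace X] (f : ℝ × X → ℝ) : Prop where
  continuous : Continuous f
  compact : HasCompactSupport f
  half : ∀ u x, u ≤ 0 → f (u, x) = 0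
  zeroMode : ∀ x, ∫ u : ℝ, f (u, x) = 0

variable {ι : Type*}

/-- Canonical modes of the half-horizon: `A_k = φ(a_k)` and `B_k = φ(b_k)` satisfy `[A_j, B_k] = i δ_jk`
and `[A_j, A_k] = [B_j, B_k] = 0`. -/
structure IsModeFamily [TopologicalSpace X] [MeasurableSpace X] (μ : Measure X)
    (a b : ι → ℝ × X → ℝ) : Prop where
  test_a : ∀ k, IsHalfTest (a k)
  test_b : ∀ k, IsHalfTest (b k)
  comm_aa : ∀ j k, commForm μ (a j) (a k) = 0
  comm_bb : ∀ j k, commForm μ (b j) (b k) = 0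
  comm_ab : ∀ k, commForm μ (a k) (b k) = 1
  comm_ab_ne : ∀ j k, j ≠ k → commForm μ (a j) (b k) = 0

/-- The test functions of the half-horizon `u > 0`: finite combinations of the modes. -/
def halfTests (a b : ι → ℝ × X → ℝ) : Submodule ℝ (ℝ × X → ℝ) :=
  Submodule.span ℝ (Set.range a ∪ Set.range b)

end Kinematics

/-! ### Functional integration and square-integrable functionals

`κ` labels finitely or infinitely many real field components. The flat measure `𝒟q` on `κ → ℝ` has no
meaning for infinite `κ`, so a functional `Ψ[q]` that is square-integrable for `𝒟q` is written as
`Ψ = F · Ω`, where `Ω = ∏ₖ √(pdf (q k))` is the amplitude of a product of centred Gaussians of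
variance `v`. Then `∫ 𝒟q |Ψ|² = ∫ |F|² dγ`, and `F` is the density that is used below. -/

section Functionals

variable {κ : Type*}

/-- The product of centred Gaussians of variance `v`; formally `Ω² 𝒟q`. -/
def gauss (κ : Type*) (v : ℝ≥0) : Measure (κ → ℝ) :=
  Measure.infinitePi fun _ : κ => gaussianReal 0 v

instance (κ : Type*) (v : ℝ≥0) : IsProbabilityMeasure (gauss κ v) := by
  unfold gauss; infer_instance

/-- The reference amplitude `Ω` of finitely many components. -/
def refAmp {κ : Type*} [Fintype κ] (v : ℝ≥0) (q : κ → ℝ) : ℝ :=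
  ∏ k, √(gaussianPDFReal 0 v (q k))

/-- The exponential `exp i (m·q + s·(-i∂_q))` of a real linear form in the field components and their
derivatives, on functionals of `q`: flatly, `Ψ[q] ↦ exp (i m·(q + s/2)) Ψ[q + s]`; on the densities
`F = Ψ / Ω` this gives the extra factor `Ω[q + s] / Ω[q]`. The vectors `m`, `s` are finitely
supported in all uses. -/
def weylAct (v : ℝ≥0) (m s : κ → ℝ) (F : (κ → ℝ) → ℂ) (q : κ → ℝ) : ℂ :=
  Complex.exp (Complex.I * ((∑ᶠ k, m k * (q k + s k / 2) : ℝ) : ℂ)) *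
    ((∏ᶠ k, √(gaussianPDFReal 0 v (q k + s k) / gaussianPDFReal 0 v (q k)) : ℝ) : ℂ) *
    F (q + s)

end Functionals

section States

variable {X : Type*} {ι : Type*}

/-- The Hilbert space of the full horizon: wavefunctionals `Ψ[φ₋]` over the `u`-odd components. The
argument is `Sum.inl k ↦ φ₋(a_k)`, `Sum.inr k ↦ φ₋(b_k)`. -/
abbrev OddSpace (ι : Type*) := Lp ℂ 2 (gauss (ι ⊕ ι) (1 / 4))

/-- Functionals `Ψ[φ(u,x); u > 0]` on the phase space of the half-horizon. The argument is
`Sum.inl k ↦ φ(a_k) = A_k`, `Sum.inr k ↦ φ(b_k) = B_k`. -/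
abbrev PhaseFunctional (ι : Type*) := (ι ⊕ ι → ℝ) → ℂ

/-- The Hilbert space of the half-horizon `u > 0`: wavefunctionals of the commuting components
`B_k = φ(b_k)`. -/
abbrev HalfSpace (ι : Type*) := Lp ℂ 2 (gauss ι (1 / 2))

/-- The substitution `φ₋(u,x) → φ(u,x)`, `u > 0`. In mode coordinates it renames the arguments
`φ₋(a_k)`, `φ₋(b_k)` to `φ(a_k)`, `φ(b_k)`. -/
def reinterpret (Ψ : OddSpace ι) : PhaseFunctional ι := Ψ

/-- `U = exp (i φ(f))` on the horizon. The `u`-odd fields are multiplication operators, so `φ(f)` has on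
the variable `φ₋(a_k)` the multiplication coefficient dictated by its commutator with the conjugate
field `φ₊(b_k)`, where `[φ₋(a_j), φ₊(b_k)] = (i/2) δ_jk`; it translates `φ₋(a_k)` by
`i [φ(f), φ₋(a_k)] = -σ(f, oddPart (a_k))`; likewise for `φ₋(b_k)`. -/
def IsHorizonExp [MeasurableSpace X] (μ : Measure X) (a b : ι → ℝ × X → ℝ) (f : ℝ × X → ℝ)
    (U : OddSpace ι →L[ℂ] OddSpace ι) : Prop :=
  U ∈ unitary (OddSpace ι →L[ℂ] OddSpace ι) ∧
  ∀ F : OddSpace ι, U F =ᵐ[gauss (ι ⊕ ι) (1 / 4)]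
    weylAct (1 / 4)
      (Sum.elim (fun k => 2 * commForm μ f (evenPart (b k)))
        (fun k => -2 * commForm μ f (evenPart (a k))))
      (Sum.elim (fun k => -commForm μ f (oddPart (a k)))
        (fun k => -commForm μ f (oddPart (b k))))
      F

/-- `U = exp (i φ(f))` on the half-horizon, `B_k` acting by multiplication and `A_k` as `i ∂/∂B_k`. -/
def IsHalfExp [MeasurableSpace X] (μ : Measure X) (a b : ι → ℝ × X → ℝ) (f : ℝ × X → ℝ)
    (U : HalfSpace ι →L[ℂ] HalfSpace ι) : Prop :=
  U ∈ unitary (HalfSpace ι →L[ℂ] HalfSpace ι) ∧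
  ∀ G : HalfSpace ι, U G =ᵐ[gauss ι (1 / 2)]
    weylAct (1 / 2) (fun k => -commForm μ f (a k)) (fun k => -commForm μ f (b k)) G

/-- `T` has trace `z`: its diagonal matrix elements sum to `z` in every orthonormal basis (such a
bounded `T` is trace class). -/
def HasTrace {E : Type*} [NormedAddCommGroup E] [InnerProductSpace ℂ E] [CompleteSpace E]
    (T : E →L[ℂ] E) (z : ℂ) : Prop :=
  ∀ (s : Set E) (e : HilbertBasis s ℂ E), HasSum (fun i => inner ℂ (e i) (T (e i))) z

/-- `ρ` is a density operator for the restriction of the pure state `Ψ` to the half-horizon `u > 0`: a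
positive operator of trace one on the half-horizon's Hilbert space that reproduces the expectation
values in `Ψ` of the field exponentials `exp (i φ(f))`, `f` supported in `u > 0`. -/
structure IsReducedDensity [MeasurableSpace X] (μ : Measure X) (a b : ι → ℝ × X → ℝ)
    (Ψ : OddSpace ι) (ρ : HalfSpace ι →L[ℂ] HalfSpace ι) : Prop where
  positive : ρ.IsPositive
  trace_one : HasTrace ρ 1
  expectation : ∀ f ∈ halfTests a b, ∃ (V : OddSpace ι →L[ℂ] OddSpace ι)
    (U : HalfSpace ι →L[ℂ] HalfSpace ι), IsHorizonExp μ a b f V ∧ IsHalfExp μ a b f U ∧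
      HasTrace (ρ ∘L U) (inner ℂ Ψ (V Ψ))

end States

/-! ### The Wigner-Weyl transform -/

section WignerWeyl

variable {ι : Type*}

/-- A continuous compactly supported wavefunction of the components `B_k`, `k ∈ J`, times the reference
amplitude in the other components, as a density. -/
def cylFun (J : Finset ι) (g : (J → ℝ) → ℂ) (q : ι → ℝ) : ℂ :=
  g (fun k => q k) / (refAmp (1 / 2) (fun k : J => q k) : ℂ)

lemma refAmp_half_pos (J : Finset ι) (q : J → ℝ) : 0 < refAmp (1 / 2) q :=
  Finset.prod_pos fun _ _ => Real.sqrt_pos.2 (gaussianPDFReal_pos _ _ _ (by norm_num))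

lemma continuous_refAmp_half (J : Finset ι) :
    Continuous fun q : J → ℝ => refAmp (1 / 2) q := by
  unfold refAmp
  simp only [gaussianPDFReal_def]
  fun_prop

lemma memLp_cylFun (J : Finset ι) (g : (J → ℝ) → ℂ) (hg : Continuous g)
    (hc : HasCompactSupport g) : MemLp (cylFun J g) 2 (gauss ι (1 / 2)) := by
  set h : (J → ℝ) → ℂ := fun q => g q / (refAmp (1 / 2) q : ℂ) with hh
  have hcont : Continuous h := by
    refine hg.div (Complex.continuous_ofReal.comp (continuous_refAmp_half J)) fun q => ?_
    exact_mod_cast (refAmp_half_pos J q).ne'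
  have hsupp : HasCompactSupport h := by
    refine hc.mono fun q hq => ?_
    simp only [hh, Function.mem_support] at hq ⊢
    intro h0
    exact hq (by rw [h0, zero_div])
  obtain ⟨C, hC⟩ := hcont.bounded_above_of_compact_support hsupp
  have hm : Measurable (cylFun J g) := by
    have h1 : Measurable fun q : ι → ℝ => (fun k : J => q k) :=
      measurable_pi_lambda _ fun k => measurable_pi_apply _
    exact hcont.measurable.comp h1
  exact MemLp.of_bound hm.aestronglyMeasurable C
    (Filter.Eventually.of_forall fun q => hC (fun k : J => q k))

/-- `cylFun` as a vector of the half-horizon's Hilbert space. -/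
def cylVec (J : Finset ι) (g : (J → ℝ) → ℂ) (hg : Continuous g) (hc : HasCompactSupport g) :
    HalfSpace ι :=
  (memLp_cylFun J g hg hc).toLp

/-- The cross-Wigner function of two wavefunctions of finitely many components `B_k`, `k ∈ J`,
`(2π)^{-|J|/2} ∫ dλ exp (i A·λ) conj (g (B - λ/2)) (h (B + λ/2))`. -/
def crossWigner (J : Finset ι) (g h : (J → ℝ) → ℂ) (A B : J → ℝ) : ℂ :=
  ((1 / √(2 * Real.pi) ^ J.card : ℝ) : ℂ) *
    ∫ l : J → ℝ, Complex.exp (Complex.I * ((∑ k, A k * l k : ℝ) : ℂ)) *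
      (starRingEnd ℂ) (g (B - (1 / 2 : ℝ) • l)) * h (B + (1 / 2 : ℝ) • l)

/-- `T` is the operator that the Wigner-Weyl transform assigns to the phase-space functional `Ψ` (given
by its density `F`): its matrix elements are `⟨g, T h⟩ = ∫ 𝒟A 𝒟B Ψ[A,B] crossWigner g h [A,B]`. With
`B₁ = B - λ/2`, `B₂ = B + λ/2` this says that `T` has the kernel
`Ψ̃[B₁,B₂] = ∫ 𝒟A exp (i A·(B₂ - B₁)) Ψ[A, (B₁ + B₂)/2]`, with `(2π)^{-1/2}` per mode absorbed in `𝒟A`.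
For `k ∉ J` both wavefunctions are the reference amplitude, whose cross-Wigner function is the
reference amplitude on phase space, hence the density `1`. -/
def IsWeylTransform (F : PhaseFunctional ι) (T : HalfSpace ι →L[ℂ] HalfSpace ι) : Prop :=
  ∀ (J : Finset ι) (g h : (J → ℝ) → ℂ) (hg : Continuous g) (hgc : HasCompactSupport g)
    (hh : Continuous h) (hhc : HasCompactSupport h),
    Integrable (fun q : ι ⊕ ι → ℝ => F q *
      (crossWigner J g h (fun k => q (Sum.inl k)) (fun k => q (Sum.inr k)) /
        (refAmp (1 / 4) (fun k : J ⊕ J => q (Sum.map Subtype.val Subtype.val k)) : ℂ)))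
      (gauss (ι ⊕ ι) (1 / 4)) ∧
    inner ℂ (cylVec J g hg hgc) (T (cylVec J h hh hhc)) =
      ∫ q : ι ⊕ ι → ℝ, F q *
        (crossWigner J g h (fun k => q (Sum.inl k)) (fun k => q (Sum.inr k)) /
          (refAmp (1 / 4) (fun k : J ⊕ J => q (Sum.map Subtype.val Subtype.val k)) : ℂ))
        ∂(gauss (ι ⊕ ι) (1 / 4))

end WignerWeyl

end Horizon

end

/-!
A test function `f = ∑ₖ (xₖ aₖ + yₖ bₖ)` of the half-horizon has complex coordinates `z = x + i y`. On
densities relative to the Gaussian amplitude, `exp (i φ(f))` is a Weyl operator `weylOp`: of `z` on the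
half-horizon, and of `oddVec z 0` on the horizon (`HasCoord.isHalfExp`, `HasCoord.isHorizonExp`; the
coefficients are commutators, and reflecting one of the two test functions to `u < 0` makes the
commutator vanish because the zero modes are absent).

The core is that the inverse Wigner–Weyl transform is an isometry onto the horizon's Hilbert space:
it sends the kernel `x(B₁) y(B₂)` to a wavefunctional `pairMap x y`, and
`⟨pairMap x y, pairMap x' y'⟩ = ⟨x, x'⟩ ⟨y, y'⟩`. So `OddSpace` is the Hilbert tensor product of two
copies of `HalfSpace`, and `exp (i φ(f))` acts on the first factor only (`pairMap_weylOp`). All of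
this can be checked on exponential vectors, `exp (c·q)` normalised: they are total
(`span_expVec_dense`, by injectivity of the characteristic function of a measure on a product of
lines), their Gram matrix is explicit, and `pairMap` sends the pair `α`, `β` of exponents to
`oddVec α β`, whose Gram matrix is the product one. This works for infinitely many modes as well as
for finitely many.

The operator `Ψ̂` is `halfOp Ψ`, defined by `⟨x, Ψ̂ y⟩ = ⟨pairMap x (conj y), Ψ⟩`. That it is the
Wigner–Weyl transform means that the cross-Wigner function of `g` and `h` is the conjugate of
`pairMap g (conj h)`. For finitely many modes both sides are integrable functions with the same
exponential moments, by Fubini and a Gaussian integral in `A` (`wave_wigner`,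
`integral_expFun_mul_wignerDensity`); functionals of finitely many modes are then embedded among all
functionals by `pullback`. Uniqueness holds because cut-off exponentials are total
(`IsWeylTransform.unique`).

Finally, `Ψ̂ Ψ̂†` is the reduction of the vector `Ψ` to the first tensor factor, which gives the
positivity, the trace and the expectation values (`hasTrace_opOf`). For uniqueness, a density operator
`ρ` has a Hilbert–Schmidt square root, so `ρ = Φ̂ Φ̂†` for some vector `Φ`, and `Φ` has the same
expectation values of the Weyl operators as `Ψ`. By the Weyl relations the families `V z Φ` and
`V z Ψ` have equal Gram matrices, hence a partial isometry that commutes with all the `V z` carries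
`Φ` to `Ψ`. The Weyl operators of the first factor are irreducible
(`exists_eq_smul_one_of_commute_weylOp`), so it acts on the second factor and does not change the
reduction (`opOf_comp_adjoint_eq_of_inner_eq`).
-/

noncomputable section

namespace Horizon

open scoped ComplexConjugate TensorProduct

/-! ### Exponential vectors of a Gaussian measure -/

section Pairing

variable {κ : Type*}

/-- The bilinear pairing `∑ k, c k * p k` of a finitely supported vector with an arbitrary one. -/
def dot (c : κ →₀ ℂ) (p : κ → ℂ) : ℂ := Finsupp.linearCombination ℂ p c

lemma dot_eq_sum (c : κ →₀ ℂ) (p : κ → ℂ) : dot c p = ∑ k ∈ c.support, c k * p k := rfl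

lemma dot_eq_sum_of_subset (c : κ →₀ ℂ) (p : κ → ℂ) {s : Finset κ} (hs : c.support ⊆ s) :
    dot c p = ∑ k ∈ s, c k * p k := by
  rw [dot_eq_sum]
  refine Finset.sum_subset hs fun k _ hk => ?_
  rw [Finsupp.notMem_support_iff.1 hk, zero_mul]

lemma dot_add_left (c d : κ →₀ ℂ) (p : κ → ℂ) : dot (c + d) p = dot c p + dot d p :=
  map_add _ _ _

lemma dot_smul_left (t : ℂ) (c : κ →₀ ℂ) (p : κ → ℂ) : dot (t • c) p = t * dot c p :=
  map_smul (Finsupp.linearCombination ℂ p) t c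

lemma dot_neg_left (c : κ →₀ ℂ) (p : κ → ℂ) : dot (-c) p = -dot c p :=
  map_neg (Finsupp.linearCombination ℂ p) c

lemma dot_zero_left (p : κ → ℂ) : dot 0 p = 0 := map_zero _

lemma dot_add_right (c : κ →₀ ℂ) (p r : κ → ℂ) : dot c (p + r) = dot c p + dot c r := by
  simp only [dot_eq_sum, Pi.add_apply, mul_add, Finset.sum_add_distrib]

lemma dot_smul_right (t : ℂ) (c : κ →₀ ℂ) (p : κ → ℂ) : dot c (t • p) = t * dot c p := by
  simp only [dot_eq_sum, Pi.smul_apply, smul_eq_mul, Finset.mul_sum]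
  exact Finset.sum_congr rfl fun _ _ => by ring

lemma dot_neg_right (c : κ →₀ ℂ) (p : κ → ℂ) : dot c (-p) = -dot c p := by
  simp [dot_eq_sum]

lemma dot_zero_right (c : κ →₀ ℂ) : dot c (0 : κ → ℂ) = 0 := by
  simp [dot_eq_sum]

lemma dot_comm (c d : κ →₀ ℂ) : dot c d = dot d c := by
  classical
  rw [dot_eq_sum_of_subset c d (Finset.subset_union_left (s₂ := d.support)),
    dot_eq_sum_of_subset d c (Finset.subset_union_right (s₁ := c.support))]
  exact Finset.sum_congr rfl fun _ _ => mul_comm _ _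

/-- The coordinatewise complex conjugate. -/
def conjVec (c : κ →₀ ℂ) : κ →₀ ℂ := c.mapRange (starRingEnd ℂ) (map_zero _)

@[simp] lemma conjVec_apply (c : κ →₀ ℂ) (k : κ) : conjVec c k = conj (c k) := rfl

@[simp] lemma conjVec_conjVec (c : κ →₀ ℂ) : conjVec (conjVec c) = c := by ext; simp

lemma conjVec_neg (c : κ →₀ ℂ) : conjVec (-c) = -conjVec c := by ext; simp

lemma conjVec_add (c d : κ →₀ ℂ) : conjVec (c + d) = conjVec c + conjVec d := by ext; simp

lemma conjVec_smul (t : ℂ) (c : κ →₀ ℂ) : conjVec (t • c) = conj t • conjVec c := by ext; simp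

lemma conjVec_zero : conjVec (0 : κ →₀ ℂ) = 0 := by ext; simp

lemma conj_dot (c : κ →₀ ℂ) (p : κ → ℂ) :
    conj (dot c p) = dot (conjVec c) (fun k => conj (p k)) := by
  have h : (conjVec c).support ⊆ c.support := Finsupp.support_mapRange
  rw [dot_eq_sum_of_subset _ _ h, dot_eq_sum, map_sum]
  simp

lemma conj_dot' (c d : κ →₀ ℂ) : conj (dot c d) = dot (conjVec c) (conjVec d) := conj_dot c d

end Pairing

section ExpFun

variable {κ : Type*}

/-- The normalised exponential `exp (c·q - v (c·c) / 2)`, of mean `1` for `gauss κ v`. -/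
def expFun (v : ℝ≥0) (c : κ →₀ ℂ) (q : κ → ℝ) : ℂ :=
  Complex.exp (dot c (fun k => (q k : ℂ)) - v / 2 * dot c c)

@[fun_prop]
lemma measurable_dot (c : κ →₀ ℂ) : Measurable fun q : κ → ℝ => dot c (fun k => (q k : ℂ)) := by
  simp only [dot_eq_sum]; fun_prop

@[fun_prop]
lemma measurable_expFun (v : ℝ≥0) (c : κ →₀ ℂ) : Measurable (expFun v c) := by
  unfold expFun; fun_prop

lemma expFun_zero (v : ℝ≥0) (q : κ → ℝ) : expFun v (0 : κ →₀ ℂ) q = 1 := by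
  simp [expFun, dot_zero_left]

lemma conj_expFun (v : ℝ≥0) (c : κ →₀ ℂ) (q : κ → ℝ) :
    conj (expFun v c q) = expFun v (conjVec c) q := by
  unfold expFun
  rw [← Complex.exp_conj, map_sub, map_mul, conj_dot', conj_dot]
  simp only [map_div₀, map_ofNat, Complex.conj_ofReal]

lemma expFun_mul (v : ℝ≥0) (c d : κ →₀ ℂ) (q : κ → ℝ) :
    expFun v c q * expFun v d q = Complex.exp (v * dot c d) * expFun v (c + d) q := by
  unfold expFun
  rw [← Complex.exp_add, ← Complex.exp_add]
  congr 1
  rw [Finsupp.coe_add, dot_add_left, dot_add_left, dot_add_right, dot_add_right, dot_comm d c]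
  ring

lemma expFun_eq_prod (v : ℝ≥0) (c : κ →₀ ℂ) (q : κ → ℝ) {s : Finset κ} (hs : c.support ⊆ s) :
    expFun v c q = ∏ k : s, Complex.exp (c k * q k - v / 2 * c k ^ 2) := by
  rw [← Complex.exp_sum, Finset.sum_coe_sort s (fun k => c k * q k - v / 2 * c k ^ 2),
    Finset.sum_sub_distrib, ← Finset.mul_sum, expFun, dot_eq_sum_of_subset _ _ hs,
    dot_eq_sum_of_subset _ _ hs]
  simp [pow_two]

lemma integrable_cexp_gaussianReal (v : ℝ≥0) (z w : ℂ) :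
    Integrable (fun x : ℝ => Complex.exp (z * x - w)) (gaussianReal 0 v) := by
  have h := (integrable_exp_mul_gaussianReal (μ := 0) (v := v) z.re).mul_const (Real.exp (-w.re))
  refine h.mono' (by fun_prop) (Filter.Eventually.of_forall fun x => ?_)
  rw [Complex.norm_exp, ← Real.exp_add]
  simp [sub_eq_add_neg]

lemma integral_cexp_gaussianReal (v : ℝ≥0) (z : ℂ) :
    ∫ x : ℝ, Complex.exp (z * x - v / 2 * z ^ 2) ∂(gaussianReal 0 v) = 1 := by
  have h := complexMGF_id_gaussianReal (μ := 0) (v := v) z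
  simp only [complexMGF, id] at h
  simp only [Complex.exp_sub, integral_div]
  rw [h]
  simp
  rw [← Complex.exp_sub, ← Complex.exp_zero]
  congr 1; ring

lemma integrable_expFun (v : ℝ≥0) (c : κ →₀ ℂ) : Integrable (expFun v c) (gauss κ v) := by
  have h : Integrable (fun q : c.support → ℝ =>
      ∏ k : c.support, Complex.exp (c k * q k - v / 2 * c k ^ 2))
      (Measure.pi fun _ : c.support => gaussianReal 0 v) :=
    Integrable.fintype_prod (f := fun (k : c.support) (x : ℝ) =>
      Complex.exp (c k * x - v / 2 * c k ^ 2))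
      fun k => integrable_cexp_gaussianReal v (c k) (v / 2 * c k ^ 2)
  rw [← Measure.infinitePi_map_restrict (fun _ : κ => gaussianReal 0 v)] at h
  refine (h.comp_measurable (Finset.measurable_restrict _)).congr
    (Filter.Eventually.of_forall fun q => ?_)
  exact (expFun_eq_prod v c q (Finset.Subset.refl _)).symm

lemma integral_expFun (v : ℝ≥0) (c : κ →₀ ℂ) : ∫ q, expFun v c q ∂(gauss κ v) = 1 := by
  have h := integral_restrict_infinitePi (μ := fun _ : κ => gaussianReal 0 v) (s := c.support)
    (f := fun q : c.support → ℝ => ∏ k : c.support, Complex.exp (c k * q k - v / 2 * c k ^ 2))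
    (Measurable.aestronglyMeasurable (by fun_prop))
  rw [integral_fintype_prod_eq_prod
    (fun (k : c.support) (x : ℝ) => Complex.exp (c k * x - v / 2 * c k ^ 2))] at h
  simp only [integral_cexp_gaussianReal, Finset.prod_const_one] at h
  rw [← h]
  exact integral_congr_ae (Filter.Eventually.of_forall fun q =>
    expFun_eq_prod v c q (Finset.Subset.refl _))

lemma memLp_expFun (v : ℝ≥0) (c : κ →₀ ℂ) : MemLp (expFun v c) 2 (gauss κ v) := by
  rw [memLp_two_iff_integrable_sq_norm (measurable_expFun v c).aestronglyMeasurable]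
  have h := ((integrable_expFun v (conjVec c + c)).const_mul
    (Complex.exp (v * dot (conjVec c) c))).norm
  refine h.congr (Filter.Eventually.of_forall fun q => ?_)
  simp only [← expFun_mul, norm_mul, ← conj_expFun, RCLike.norm_conj, pow_two]

/-- The exponential vector of `c`. -/
def expVec (v : ℝ≥0) (c : κ →₀ ℂ) : Lp ℂ 2 (gauss κ v) := (memLp_expFun v c).toLp

lemma coeFn_expVec (v : ℝ≥0) (c : κ →₀ ℂ) : expVec v c =ᵐ[gauss κ v] expFun v c :=
  (memLp_expFun v c).coeFn_toLp

lemma inner_expVec_left (v : ℝ≥0) (c : κ →₀ ℂ) (F : Lp ℂ 2 (gauss κ v)) :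
    inner ℂ (expVec v c) F = ∫ q, expFun v (conjVec c) q * F q ∂(gauss κ v) := by
  rw [L2.inner_def]
  refine integral_congr_ae ?_
  filter_upwards [coeFn_expVec v c] with q hq
  rw [hq, RCLike.inner_apply, conj_expFun, mul_comm]

/-- The Gram matrix of the exponential vectors. -/
lemma inner_expVec (v : ℝ≥0) (c d : κ →₀ ℂ) :
    inner ℂ (expVec v c) (expVec v d) = Complex.exp (v * dot (conjVec c) d) := by
  rw [inner_expVec_left]
  have : (fun q => expFun v (conjVec c) q * expVec v d q) =ᵐ[gauss κ v]
      fun q => Complex.exp (v * dot (conjVec c) d) * expFun v (conjVec c + d) q := by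
    filter_upwards [coeFn_expVec v d] with q hq
    rw [hq, expFun_mul]
  rw [integral_congr_ae this, integral_const_mul, integral_expFun, mul_one]

end ExpFun

section Totality

variable {κ : Type*}

/-- The imaginary vector `i m`. -/
def imagVec (m : κ →₀ ℝ) : κ →₀ ℂ := m.mapRange (fun x : ℝ => (x : ℂ) * Complex.I) (by simp)

@[simp] lemma imagVec_apply (m : κ →₀ ℝ) (k : κ) : imagVec m k = m k * Complex.I := rfl

lemma conjVec_imagVec (m : κ →₀ ℝ) : conjVec (imagVec m) = imagVec (-m) := by ext; simp

lemma norm_exp_dot_imagVec (m : κ →₀ ℝ) (q : κ → ℝ) :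
    ‖Complex.exp (dot (imagVec m) (fun k => (q k : ℂ)))‖ = 1 := by
  rw [Complex.norm_exp, dot_eq_sum]
  simp

/-- A finite measure on a product of lines is determined by its characteristic function. -/
theorem ext_of_integral_exp_imagVec {P Q : Measure (κ → ℝ)} [IsFiniteMeasure P] [IsFiniteMeasure Q]
    (h : ∀ m : κ →₀ ℝ, ∫ q, Complex.exp (dot (imagVec m) (fun k => (q k : ℂ))) ∂P
      = ∫ q, Complex.exp (dot (imagVec m) (fun k => (q k : ℂ))) ∂Q) : P = Q := by
  classical
  have key : IsProjectiveLimit P fun J : Finset κ => Q.map J.restrict := by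
    intro J
    refine Measure.ext_of_charFunDual (funext fun L => ?_)
    set m : κ →₀ ℝ := Finsupp.onFinset J
      (fun k => if hk : k ∈ J then L (Pi.single ⟨k, hk⟩ 1) else 0)
      (fun k hk => by by_contra hk'; simp [hk'] at hk) with hm
    have hL : ∀ q : κ → ℝ, Complex.exp (L (J.restrict q) * Complex.I)
        = Complex.exp (dot (imagVec m) (fun k => (q k : ℂ))) := by
      intro q
      congr 1
      have hs : (imagVec m).support ⊆ J :=
        Finsupp.support_mapRange.trans Finsupp.support_onFinset_subset
      rw [dot_eq_sum_of_subset _ _ hs, ← Finset.sum_coe_sort J]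
      have h1 : J.restrict q = ∑ k : J, q k • (Pi.single k (1 : ℝ) : J → ℝ) := by
        ext j
        simp [Finset.sum_apply, Pi.single_apply]
      rw [h1, map_sum]
      push_cast
      rw [Finset.sum_mul]
      refine Finset.sum_congr rfl fun k _ => ?_
      simp [hm]
      ring
    rw [charFunDual_apply, charFunDual_apply, integral_map (by fun_prop) (by fun_prop),
      integral_map (by fun_prop) (by fun_prop)]
    simp only [hL, h m]
  exact key.unique (fun J => rfl)

lemma ae_eq_zero_of_integral_exp_imagVec_real {P : Measure (κ → ℝ)} [IsFiniteMeasure P]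
    {f : (κ → ℝ) → ℝ} (hf : Integrable f P)
    (h : ∀ m : κ →₀ ℝ,
      ∫ q, Complex.exp (dot (imagVec m) (fun k => (q k : ℂ))) * (f q : ℂ) ∂P = 0) :
    f =ᵐ[P] 0 := by
  have := isFiniteMeasure_withDensity_ofReal hf.2
  have := isFiniteMeasure_withDensity_ofReal hf.neg.2
  have hpos : AEMeasurable (fun q => ENNReal.ofReal (f q)) P := hf.aemeasurable.ennreal_ofReal
  have hneg : AEMeasurable (fun q => ENNReal.ofReal ((-f) q)) P :=
    hf.neg.aemeasurable.ennreal_ofReal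
  have heq : P.withDensity (fun q => ENNReal.ofReal (f q))
      = P.withDensity (fun q => ENNReal.ofReal ((-f) q)) := by
    refine ext_of_integral_exp_imagVec fun m => ?_
    rw [integral_withDensity_eq_integral_toReal_smul₀ hpos (by simp),
      integral_withDensity_eq_integral_toReal_smul₀ hneg (by simp), ← sub_eq_zero, ← integral_sub]
    · rw [← h m]
      refine integral_congr_ae (Filter.Eventually.of_forall fun q => ?_)
      simp only [ENNReal.toReal_ofReal', Pi.neg_apply, Complex.real_smul]
      rw [← sub_mul, mul_comm]
      congr 1
      rw [← Complex.ofReal_sub, max_zero_sub_max_neg_zero_eq_self]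
    · simp only [ENNReal.toReal_ofReal']
      exact Integrable.smul_bdd (𝕜 := ℝ) (C := 1)
        (f := fun q : κ → ℝ => Complex.exp (dot (imagVec m) (fun k => (q k : ℂ)))) hf.pos_part
        (Measurable.aestronglyMeasurable (by fun_prop))
        (Filter.Eventually.of_forall fun q => (norm_exp_dot_imagVec m q).le)
    · simp only [ENNReal.toReal_ofReal', Pi.neg_apply]
      exact Integrable.smul_bdd (𝕜 := ℝ) (C := 1)
        (f := fun q : κ → ℝ => Complex.exp (dot (imagVec m) (fun k => (q k : ℂ)))) hf.neg_part
        (Measurable.aestronglyMeasurable (by fun_prop))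
        (Filter.Eventually.of_forall fun q => (norm_exp_dot_imagVec m q).le)
  rw [withDensity_eq_iff hpos hneg hf.lintegral_lt_top.ne] at heq
  filter_upwards [heq] with q hq
  simp only [Pi.neg_apply, Pi.zero_apply] at hq ⊢
  rcases le_total (f q) 0 with h0 | h0
  · rw [ENNReal.ofReal_of_nonpos h0, eq_comm, ENNReal.ofReal_eq_zero] at hq
    linarith
  · rw [ENNReal.ofReal_of_nonpos (neg_nonpos.2 h0), ENNReal.ofReal_eq_zero] at hq
    linarith

/-- An integrable function whose Fourier coefficients against all finite-dimensional characters
vanish is zero. Integrability, rather than square-integrability, is what makes this usable for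
Wigner functions. -/
theorem ae_eq_zero_of_integral_exp_imagVec {P : Measure (κ → ℝ)} [IsFiniteMeasure P]
    {G : (κ → ℝ) → ℂ} (hG : Integrable G P)
    (h : ∀ m : κ →₀ ℝ, ∫ q, Complex.exp (dot (imagVec m) (fun k => (q k : ℂ))) * G q ∂P = 0) :
    G =ᵐ[P] 0 := by
  have hint : ∀ (m : κ →₀ ℝ) {G' : (κ → ℝ) → ℂ}, Integrable G' P →
      Integrable (fun q => Complex.exp (dot (imagVec m) (fun k => (q k : ℂ))) * G' q) P :=
    fun m G' hG' => hG'.bdd_mul (c := 1) (Measurable.aestronglyMeasurable (by fun_prop))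
      (Filter.Eventually.of_forall fun q => (norm_exp_dot_imagVec m q).le)
  have hGc : Integrable (fun q => conj (G q)) P := by
    refine hG.congr' ?_ (Filter.Eventually.of_forall fun q => (RCLike.norm_conj _).symm)
    exact Complex.continuous_conj.comp_aestronglyMeasurable hG.1
  have hconj : ∀ m : κ →₀ ℝ,
      ∫ q, Complex.exp (dot (imagVec m) (fun k => (q k : ℂ))) * conj (G q) ∂P = 0 := by
    intro m
    have h1 := congrArg conj (h (-m))
    rw [← integral_conj, map_zero] at h1
    rw [← h1]
    refine integral_congr_ae (Filter.Eventually.of_forall fun q => ?_)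
    simp only [map_mul, ← Complex.exp_conj, conj_dot, conjVec_imagVec, neg_neg,
      Complex.conj_ofReal]
  have hre : (fun q => (G q).re) =ᵐ[P] 0 := by
    refine ae_eq_zero_of_integral_exp_imagVec_real hG.re fun m => ?_
    have h1 : ∀ q, Complex.exp (dot (imagVec m) (fun k => (q k : ℂ))) * ((G q).re : ℂ)
        = (1 / 2) * (Complex.exp (dot (imagVec m) (fun k => (q k : ℂ))) * G q
          + Complex.exp (dot (imagVec m) (fun k => (q k : ℂ))) * conj (G q)) := by
      intro q
      rw [Complex.re_eq_add_conj]; ring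
    have h2 := integral_add (hint m hG) (hint m hGc)
    rw [h m, hconj m, add_zero] at h2
    calc _ = ∫ q, (1 / 2) * (Complex.exp (dot (imagVec m) (fun k => (q k : ℂ))) * G q
          + Complex.exp (dot (imagVec m) (fun k => (q k : ℂ))) * conj (G q)) ∂P :=
          integral_congr_ae (Filter.Eventually.of_forall h1)
      _ = 0 := by rw [integral_const_mul, h2, mul_zero]
  have him : (fun q => (G q).im) =ᵐ[P] 0 := by
    refine ae_eq_zero_of_integral_exp_imagVec_real hG.im fun m => ?_
    have h1 : ∀ q, Complex.exp (dot (imagVec m) (fun k => (q k : ℂ))) * ((G q).im : ℂ)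
        = (1 / (2 * Complex.I)) * (Complex.exp (dot (imagVec m) (fun k => (q k : ℂ))) * G q
          - Complex.exp (dot (imagVec m) (fun k => (q k : ℂ))) * conj (G q)) := by
      intro q
      rw [Complex.im_eq_sub_conj]; ring
    have h2 := integral_sub (hint m hG) (hint m hGc)
    rw [h m, hconj m, sub_zero] at h2
    calc _ = ∫ q, (1 / (2 * Complex.I)) * (Complex.exp (dot (imagVec m) (fun k => (q k : ℂ))) * G q
          - Complex.exp (dot (imagVec m) (fun k => (q k : ℂ))) * conj (G q)) ∂P :=
          integral_congr_ae (Filter.Eventually.of_forall h1)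
      _ = 0 := by rw [integral_const_mul, h2, mul_zero]
  filter_upwards [hre, him] with q h1 h2
  exact Complex.ext h1 h2

lemma expFun_imagVec (v : ℝ≥0) (m : κ →₀ ℝ) (q : κ → ℝ) :
    expFun v (imagVec m) q = Complex.exp (-(v / 2 * dot (imagVec m) (imagVec m)))
      * Complex.exp (dot (imagVec m) (fun k => (q k : ℂ))) := by
  rw [expFun, ← Complex.exp_add]; ring_nf

/-- Two integrable densities with the same pairings with imaginary exponentials agree. -/
lemma ae_eq_of_integral_expFun {v : ℝ≥0} {G G' : (κ → ℝ) → ℂ} (hG : Integrable G (gauss κ v))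
    (hG' : Integrable G' (gauss κ v))
    (h : ∀ m : κ →₀ ℝ, ∫ q, expFun v (imagVec m) q * G q ∂(gauss κ v)
      = ∫ q, expFun v (imagVec m) q * G' q ∂(gauss κ v)) : G =ᵐ[gauss κ v] G' := by
  have hb : ∀ (m : κ →₀ ℝ) {G' : (κ → ℝ) → ℂ}, Integrable G' (gauss κ v) →
      Integrable (fun q => Complex.exp (dot (imagVec m) (fun k => (q k : ℂ))) * G' q)
        (gauss κ v) :=
    fun m G' hG' => hG'.bdd_mul (c := 1) (Measurable.aestronglyMeasurable (by fun_prop))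
      (Filter.Eventually.of_forall fun q => (norm_exp_dot_imagVec m q).le)
  have h0 : G - G' =ᵐ[gauss κ v] 0 := by
    refine ae_eq_zero_of_integral_exp_imagVec (hG.sub hG') fun m => ?_
    have hm := h m
    simp only [expFun_imagVec, mul_assoc, integral_const_mul] at hm
    have hm' := mul_left_cancel₀ (Complex.exp_ne_zero _) hm
    simp only [Pi.sub_apply, mul_sub]
    rw [integral_sub (hb m hG) (hb m hG'), hm', sub_self]
  filter_upwards [h0] with q hq
  exact sub_eq_zero.1 hq

/-- The exponential vectors of imaginary vectors are total. -/
lemma eq_zero_of_inner_expVec_imagVec {v : ℝ≥0} {F : Lp ℂ 2 (gauss κ v)}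
    (h : ∀ m : κ →₀ ℝ, inner ℂ (expVec v (imagVec m)) F = 0) : F = 0 := by
  have hF : (F : (κ → ℝ) → ℂ) =ᵐ[gauss κ v] fun _ => 0 := by
    refine ae_eq_of_integral_expFun ((Lp.memLp F).integrable one_le_two)
      (integrable_zero _ _ _) fun m => ?_
    have := h (-m)
    rw [inner_expVec_left, conjVec_imagVec, neg_neg] at this
    rw [this]; simp
  exact (Lp.eq_zero_iff_ae_eq_zero).2 hF

lemma span_expVec_dense (κ : Type*) (v : ℝ≥0) :
    (Submodule.span ℂ (Set.range (expVec (κ := κ) v))).topologicalClosure = ⊤ := by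
  rw [Submodule.topologicalClosure_eq_top_iff, Submodule.eq_bot_iff]
  intro F hF
  refine eq_zero_of_inner_expVec_imagVec fun m => ?_
  exact (Submodule.mem_orthogonal _ _).1 hF _ (Submodule.subset_span ⟨_, rfl⟩)

end Totality

/-! ### Weyl operators -/

section Weyl

variable {κ : Type*}

/-- The coordinatewise real part, as a complex vector. -/
def reVec (z : κ →₀ ℂ) : κ →₀ ℂ := (1 / 2 : ℂ) • (z + conjVec z)

lemma reVec_apply (z : κ →₀ ℂ) (k : κ) : reVec z k = ((z k).re : ℂ) := by
  simp [reVec, Complex.re_eq_add_conj]; ring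

/-- The translation performed by the Weyl operator of `z`. -/
def weylShift (v : ℝ≥0) (z : κ →₀ ℂ) : κ → ℝ := fun k => -2 * v * (z k).re

/-- The multiplier of the Weyl operator of `z`. -/
def weylFactor (v : ℝ≥0) (z : κ →₀ ℂ) (q : κ → ℝ) : ℂ :=
  Complex.exp (dot z (fun k => (q k : ℂ)) - v * dot z (reVec z))

@[fun_prop]
lemma measurable_weylFactor (v : ℝ≥0) (z : κ →₀ ℂ) : Measurable (weylFactor v z) := by
  unfold weylFactor; fun_prop

lemma dot_weylShift (v : ℝ≥0) (z c : κ →₀ ℂ) :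
    dot c (fun k => (weylShift v z k : ℂ)) = -2 * v * dot c (reVec z) := by
  rw [← dot_smul_right]
  congr 1
  ext k
  simp [weylShift, reVec_apply]

lemma dot_add_weylShift (v : ℝ≥0) (z c : κ →₀ ℂ) (q : κ → ℝ) :
    dot c (fun k => ((q + weylShift v z) k : ℂ))
      = dot c (fun k => (q k : ℂ)) - 2 * v * dot c (reVec z) := by
  have : (fun k => ((q + weylShift v z) k : ℂ))
      = (fun k => (q k : ℂ)) + fun k => (weylShift v z k : ℂ) := by ext k; simp
  rw [this, dot_add_right, dot_weylShift]
  ring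

lemma sq_norm_weylFactor (v : ℝ≥0) (z : κ →₀ ℂ) (q : κ → ℝ) :
    ((‖weylFactor v z q‖ ^ 2 : ℝ) : ℂ) = expFun v ((2 : ℂ) • reVec z) q := by
  rw [Complex.ofReal_pow, ← Complex.conj_mul', weylFactor, ← Complex.exp_conj, ← Complex.exp_add,
    expFun]
  congr 1
  have h1 : conjVec (reVec z) = reVec z := by ext k; simp [reVec_apply]
  rw [map_sub, map_mul, Complex.conj_ofReal, conj_dot', conj_dot, h1]
  simp only [Complex.conj_ofReal, reVec, dot_smul_left, dot_smul_right, dot_add_left,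
    dot_add_right, Finsupp.coe_smul, Finsupp.coe_add]
  ring

lemma weylAct_eq {v : ℝ≥0} (hv : v ≠ 0) (z : κ →₀ ℂ) (F : (κ → ℝ) → ℂ) (q : κ → ℝ) :
    weylAct v (fun k => (z k).im) (weylShift v z) F q
      = weylFactor v z q * F (q + weylShift v z) := by
  have hv' : (v : ℝ) ≠ 0 := by exact_mod_cast hv
  have h1 : (∑ᶠ k, (z k).im * (q k + weylShift v z k / 2))
      = ∑ k ∈ z.support, (z k).im * (q k + weylShift v z k / 2) := by
    refine finsum_eq_sum_of_support_subset _ fun k hk => ?_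
    simp only [Function.mem_support, Finset.mem_coe, Finsupp.mem_support_iff] at hk ⊢
    rintro h0
    simp [h0] at hk
  have h2 : (∏ᶠ k, √(gaussianPDFReal 0 v (q k + weylShift v z k) / gaussianPDFReal 0 v (q k)))
      = ∏ k ∈ z.support, Real.exp ((z k).re * q k - v * (z k).re ^ 2) := by
    rw [finprod_eq_prod_of_mulSupport_subset (s := z.support)]
    · refine Finset.prod_congr rfl fun k _ => ?_
      have h3 : gaussianPDFReal 0 v (q k + weylShift v z k) / gaussianPDFReal 0 v (q k)
          = Real.exp (2 * ((z k).re * q k - v * (z k).re ^ 2)) := by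
        simp only [gaussianPDFReal_def]
        rw [mul_div_mul_left _ _ (by positivity), ← Real.exp_sub]
        congr 1
        simp only [weylShift]
        field_simp
        ring
      rw [h3, two_mul, Real.exp_add, Real.sqrt_mul_self (Real.exp_nonneg _)]
    · intro k hk
      simp only [Function.mem_mulSupport, Finset.mem_coe, Finsupp.mem_support_iff] at hk ⊢
      rintro h0
      apply hk
      rw [show weylShift v z k = 0 by simp [weylShift, h0], add_zero,
        div_self (gaussianPDFReal_pos _ _ _ hv).ne', Real.sqrt_one]
  rw [weylAct, h1, h2, weylFactor]
  congr 1
  push_cast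
  rw [← Complex.exp_sum, ← Complex.exp_add]
  congr 1
  rw [dot_eq_sum, dot_eq_sum, Finset.mul_sum, Finset.mul_sum, ← Finset.sum_add_distrib,
    ← Finset.sum_sub_distrib]
  refine Finset.sum_congr rfl fun k _ => ?_
  rw [reVec_apply]
  simp only [weylShift]
  push_cast
  linear_combination ((q k : ℂ) - v * (z k).re) * Complex.re_add_im (z k)

/-- Cameron–Martin: the weight `|weylFactor|²` compensates the translation by `weylShift`. -/
theorem map_add_weylShift (v : ℝ≥0) (z : κ →₀ ℂ) :
    ((gauss κ v).withDensity (fun q => ENNReal.ofReal (‖weylFactor v z q‖ ^ 2))).map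
      (fun q => q + weylShift v z) = gauss κ v := by
  have hint : Integrable (fun q => ‖weylFactor v z q‖ ^ 2) (gauss κ v) := by
    refine (integrable_expFun v ((2 : ℂ) • reVec z)).re.congr
      (Filter.Eventually.of_forall fun q => ?_)
    simp only [← sq_norm_weylFactor]
    rfl
  have := isFiniteMeasure_withDensity_ofReal hint.2
  have hm : Measurable fun q : κ → ℝ => q + weylShift v z := by fun_prop
  have hd : ∀ (m : κ →₀ ℝ) (q : κ → ℝ), Complex.exp (dot (imagVec m) (fun k => (q k : ℂ)))
      = Complex.exp (v / 2 * dot (imagVec m) (imagVec m)) * expFun v (imagVec m) q := by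
    intro m q
    rw [expFun, ← Complex.exp_add]; ring_nf
  refine ext_of_integral_exp_imagVec fun m => ?_
  rw [integral_map hm.aemeasurable (Measurable.aestronglyMeasurable (by fun_prop)),
    integral_withDensity_eq_integral_toReal_smul₀ (by fun_prop) (by simp)]
  simp only [ENNReal.toReal_ofReal (sq_nonneg _), Complex.real_smul, sq_norm_weylFactor]
  have h1 : ∀ q : κ → ℝ, expFun v ((2 : ℂ) • reVec z) q
        * Complex.exp (dot (imagVec m) (fun k => ((q + weylShift v z) k : ℂ)))
      = Complex.exp (v / 2 * dot (imagVec m) (imagVec m))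
        * expFun v ((2 : ℂ) • reVec z + imagVec m) q := by
    intro q
    rw [dot_add_weylShift, expFun, expFun, ← Complex.exp_add, ← Complex.exp_add]
    congr 1
    simp only [dot_smul_left, dot_smul_right, dot_add_left, dot_add_right, Finsupp.coe_smul,
      Finsupp.coe_add]
    rw [dot_comm (imagVec m) (reVec z)]
    ring
  simp only [h1, integral_const_mul, integral_expFun]
  simp only [hd, integral_const_mul, integral_expFun]

lemma ae_add_weylShift (v : ℝ≥0) (z : κ →₀ ℂ) {p : (κ → ℝ) → Prop} (h : ∀ᵐ q ∂(gauss κ v), p q) :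
    ∀ᵐ q ∂(gauss κ v), p (q + weylShift v z) := by
  rw [← map_add_weylShift v z] at h
  have h1 := ae_of_ae_map (Measurable.aemeasurable (by fun_prop)) h
  rw [ae_withDensity_iff (by fun_prop)] at h1
  filter_upwards [h1] with q hq
  refine hq (ENNReal.ofReal_pos.2 (pow_pos (norm_pos_iff.2 (Complex.exp_ne_zero _)) 2)).ne'

lemma integrable_weylShift {v : ℝ≥0} (z : κ →₀ ℂ) {G : (κ → ℝ) → ℝ} (hG : Integrable G (gauss κ v)) :
    Integrable (fun q => ‖weylFactor v z q‖ ^ 2 * G (q + weylShift v z)) (gauss κ v) := by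
  rw [← map_add_weylShift v z] at hG
  have h1 := hG.comp_measurable (by fun_prop)
  rw [integrable_withDensity_iff_integrable_smul' (by fun_prop) (by simp)] at h1
  simpa only [ENNReal.toReal_ofReal (sq_nonneg _), smul_eq_mul, Function.comp_def] using h1

lemma integral_weylShift {v : ℝ≥0} (z : κ →₀ ℂ) {G : (κ → ℝ) → ℝ} (hG : Integrable G (gauss κ v)) :
    ∫ q, ‖weylFactor v z q‖ ^ 2 * G (q + weylShift v z) ∂(gauss κ v) = ∫ q, G q ∂(gauss κ v) := by
  have hG' := hG.1
  conv_rhs => rw [← map_add_weylShift v z]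
  rw [← map_add_weylShift v z] at hG'
  rw [integral_map (Measurable.aemeasurable (by fun_prop)) hG',
    integral_withDensity_eq_integral_toReal_smul₀ (by fun_prop) (by simp)]
  simp only [ENNReal.toReal_ofReal (sq_nonneg _), smul_eq_mul]

lemma memLp_weyl {v : ℝ≥0} (z : κ →₀ ℂ) (F : Lp ℂ 2 (gauss κ v)) :
    MemLp (fun q => weylFactor v z q * F (q + weylShift v z)) 2 (gauss κ v) := by
  have hm : AEStronglyMeasurable (fun q => F (q + weylShift v z)) (gauss κ v) :=
    ((Lp.stronglyMeasurable F).comp_measurable (by fun_prop)).aestronglyMeasurable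
  have hm' : AEStronglyMeasurable (fun q => weylFactor v z q * F (q + weylShift v z))
      (gauss κ v) := (measurable_weylFactor v z).aestronglyMeasurable.mul hm
  rw [memLp_two_iff_integrable_sq_norm hm']
  simp only [norm_mul, mul_pow]
  exact integrable_weylShift z (Lp.memLp F).integrable_norm_pow'

/-- The Weyl operator of `z`, which maps `F` to `q ↦ weylFactor v z q * F (q + weylShift v z)`. -/
def weylIso (v : ℝ≥0) (z : κ →₀ ℂ) : Lp ℂ 2 (gauss κ v) →ₗᵢ[ℂ] Lp ℂ 2 (gauss κ v) where
  toFun F := (memLp_weyl z F).toLp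
  map_add' F G := by
    rw [← MemLp.toLp_add, MemLp.toLp_eq_toLp_iff]
    filter_upwards [ae_add_weylShift v z (Lp.coeFn_add F G)] with q hq
    simp only [hq, Pi.add_apply, mul_add]
  map_smul' t F := by
    rw [RingHom.id_apply, ← MemLp.toLp_const_smul, MemLp.toLp_eq_toLp_iff]
    filter_upwards [ae_add_weylShift v z (Lp.coeFn_smul t F)] with q hq
    simp only [hq, Pi.smul_apply, smul_eq_mul]
    ring
  norm_map' F := by
    have hsq : ∀ G : Lp ℂ 2 (gauss κ v), ‖G‖ ^ 2 = ∫ q, ‖G q‖ ^ 2 ∂(gauss κ v) := by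
      intro G
      have h1 := inner_self_eq_norm_sq_to_K (𝕜 := ℂ) G
      rw [L2.inner_def] at h1
      simp only [inner_self_eq_norm_sq_to_K] at h1
      norm_cast at h1
      exact h1.symm
    have : ‖(memLp_weyl z F).toLp‖ ^ 2 = ‖F‖ ^ 2 := by
      rw [hsq, hsq, ← integral_weylShift z (Lp.memLp F).integrable_norm_pow']
      refine integral_congr_ae ?_
      filter_upwards [(memLp_weyl z F).coeFn_toLp] with q hq
      rw [hq, norm_mul, mul_pow]
    exact (sq_eq_sq₀ (norm_nonneg _) (norm_nonneg _)).1 this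

/-- The Weyl operator of `z`, as a bounded operator. -/
def weylOp (v : ℝ≥0) (z : κ →₀ ℂ) : Lp ℂ 2 (gauss κ v) →L[ℂ] Lp ℂ 2 (gauss κ v) :=
  (weylIso v z).toContinuousLinearMap

lemma coeFn_weylOp (v : ℝ≥0) (z : κ →₀ ℂ) (F : Lp ℂ 2 (gauss κ v)) :
    weylOp v z F =ᵐ[gauss κ v] fun q => weylFactor v z q * F (q + weylShift v z) :=
  (memLp_weyl z F).coeFn_toLp

lemma weylOp_ae_eq_weylAct {v : ℝ≥0} (hv : v ≠ 0) (z : κ →₀ ℂ) (F : Lp ℂ 2 (gauss κ v)) :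
    weylOp v z F =ᵐ[gauss κ v] weylAct v (fun k => (z k).im) (weylShift v z) F := by
  filter_upwards [coeFn_weylOp v z F] with q hq
  rw [hq, weylAct_eq hv]

/-- The scalar by which the Weyl operator of `z` multiplies the exponential vector of `c` in addition
to translating `c` by `z`. -/
def weylPhase (v : ℝ≥0) (z c : κ →₀ ℂ) : ℂ :=
  Complex.exp (-(v / 2 * dot (conjVec z) z) - v * dot (conjVec z) c)

lemma weylPhase_ne_zero (v : ℝ≥0) (z c : κ →₀ ℂ) : weylPhase v z c ≠ 0 := Complex.exp_ne_zero _

lemma weylOp_expVec (v : ℝ≥0) (z c : κ →₀ ℂ) :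
    weylOp v z (expVec v c) = weylPhase v z c • expVec v (c + z) := by
  refine Lp.ext ?_
  filter_upwards [coeFn_weylOp v z (expVec v c), Lp.coeFn_smul (weylPhase v z c) (expVec v (c + z)),
    coeFn_expVec v (c + z), ae_add_weylShift v z (coeFn_expVec v c)] with q h1 h2 h3 h4
  rw [h1, h2, h4, Pi.smul_apply, h3, smul_eq_mul, weylFactor, weylPhase, expFun, expFun,
    ← Complex.exp_add, ← Complex.exp_add, dot_add_weylShift]
  congr 1
  simp only [reVec, dot_smul_right, dot_add_left, dot_add_right, Finsupp.coe_smul,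
    Finsupp.coe_add]
  rw [dot_comm z c, dot_comm (conjVec z) z, dot_comm (conjVec z) c]
  ring

/-- Bounded operators that agree on the exponential vectors agree. -/
lemma clm_ext_expVec {v : ℝ≥0} {E : Type*} [NormedAddCommGroup E] [NormedSpace ℂ E]
    {S T : Lp ℂ 2 (gauss κ v) →L[ℂ] E} (h : ∀ c, S (expVec v c) = T (expVec v c)) : S = T := by
  refine ContinuousLinearMap.ext_on (s := Set.range (expVec (κ := κ) v)) ?_ ?_
  · rw [dense_iff_closure_eq]
    have := span_expVec_dense κ v
    rw [← Submodule.topologicalClosure_coe, this]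
    rfl
  · rintro _ ⟨c, rfl⟩
    exact h c

lemma weylOp_neg_mul_weylOp (v : ℝ≥0) (z : κ →₀ ℂ) : weylOp v (-z) * weylOp v z = 1 := by
  refine clm_ext_expVec fun c => ?_
  rw [mul_apply_eq_comp, weylOp_expVec, map_smul, weylOp_expVec, smul_smul, weylPhase,
    weylPhase, ← Complex.exp_add, add_neg_cancel_right, one_apply_eq_self]
  convert one_smul ℂ _
  rw [← Complex.exp_zero]
  congr 1
  simp only [conjVec_neg, dot_neg_left, dot_neg_right, Finsupp.coe_neg, Finsupp.coe_add,
    dot_add_right]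
  ring

lemma weylOp_mul_weylOp_neg (v : ℝ≥0) (z : κ →₀ ℂ) : weylOp v z * weylOp v (-z) = 1 := by
  simpa using weylOp_neg_mul_weylOp v (-z)

lemma star_weylOp (v : ℝ≥0) (z : κ →₀ ℂ) : star (weylOp v z) = weylOp v (-z) := by
  have h1 : star (weylOp v z) * weylOp v z = 1 := by
    rw [ContinuousLinearMap.star_eq_adjoint]
    exact (ContinuousLinearMap.norm_map_iff_adjoint_comp_self _).1 (weylIso v z).norm_map
  calc star (weylOp v z) = star (weylOp v z) * (weylOp v z * weylOp v (-z)) := by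
        rw [weylOp_mul_weylOp_neg, mul_one]
    _ = weylOp v (-z) := by rw [← mul_assoc, h1, one_mul]

lemma adjoint_weylOp (v : ℝ≥0) (z : κ →₀ ℂ) :
    ContinuousLinearMap.adjoint (weylOp v z) = weylOp v (-z) := star_weylOp v z

lemma weylOp_mem_unitary (v : ℝ≥0) (z : κ →₀ ℂ) :
    weylOp v z ∈ unitary (Lp ℂ 2 (gauss κ v) →L[ℂ] Lp ℂ 2 (gauss κ v)) := by
  rw [Unitary.mem_iff, star_weylOp]
  exact ⟨weylOp_neg_mul_weylOp v z, weylOp_mul_weylOp_neg v z⟩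

/-- The Weyl relation. -/
lemma weylOp_mul (v : ℝ≥0) (z w : κ →₀ ℂ) :
    weylOp v z * weylOp v w = Complex.exp (v / 2 * (dot (conjVec w) z - dot (conjVec z) w)) •
      weylOp v (z + w) := by
  refine clm_ext_expVec fun c => ?_
  rw [mul_apply_eq_comp, weylOp_expVec, map_smul, weylOp_expVec, smul_smul,
    smul_apply, weylOp_expVec, smul_smul, weylPhase, weylPhase, weylPhase,
    ← Complex.exp_add, ← Complex.exp_add, add_comm z w, add_assoc]
  congr 2
  simp only [conjVec_add, dot_add_left, Finsupp.coe_add, dot_add_right]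
  ring

end Weyl

/-! ### Isometries and tensor products determined by Gram matrices -/

section Gram

variable {I E F : Type*} [NormedAddCommGroup E] [InnerProductSpace ℂ E]
  [NormedAddCommGroup F] [InnerProductSpace ℂ F]

lemma mem_of_dense_span {v : I → E} (hv : (Submodule.span ℂ (Set.range v)).topologicalClosure = ⊤)
    {S : Submodule ℂ E} (hS : IsClosed (S : Set E)) (h : ∀ i, v i ∈ S) (x : E) : x ∈ S := by
  have h1 : (Submodule.span ℂ (Set.range v)).topologicalClosure ≤ S :=
    Submodule.topologicalClosure_minimal _
      (Submodule.span_le.2 (by rintro _ ⟨i, rfl⟩; exact h i)) hS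
  exact h1 (hv ▸ Submodule.mem_top)

lemma norm_linearCombination_eq_of_gram {v : I → E} {w : I → F}
    (h : ∀ i j, inner ℂ (w i) (w j) = inner ℂ (v i) (v j)) (a : I →₀ ℂ) :
    ‖Finsupp.linearCombination ℂ w a‖ = ‖Finsupp.linearCombination ℂ v a‖ := by
  have h1 : inner ℂ (Finsupp.linearCombination ℂ w a) (Finsupp.linearCombination ℂ w a)
      = inner ℂ (Finsupp.linearCombination ℂ v a) (Finsupp.linearCombination ℂ v a) := by
    simp only [Finsupp.linearCombination_apply, Finsupp.sum, sum_inner, inner_sum,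
      inner_smul_left, inner_smul_right, h]
  rw [@norm_eq_sqrt_re_inner ℂ, @norm_eq_sqrt_re_inner ℂ, h1]

/-- Two families of vectors with the same Gram matrix are related by a linear isometry, if the
first is total. -/
theorem exists_linearIsometry_of_gram [CompleteSpace F] {v : I → E} {w : I → F}
    (hv : (Submodule.span ℂ (Set.range v)).topologicalClosure = ⊤)
    (h : ∀ i j, inner ℂ (w i) (w j) = inner ℂ (v i) (v j)) :
    ∃ U : E →ₗᵢ[ℂ] F, ∀ i, U (v i) = w i := by
  set e := Finsupp.linearCombination ℂ v
  set f := Finsupp.linearCombination ℂ w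
  have hn : ∀ a, ‖f a‖ = ‖e a‖ := norm_linearCombination_eq_of_gram h
  have hdense : DenseRange e := by
    rw [DenseRange, ← LinearMap.coe_range, Finsupp.range_linearCombination]
    exact (Submodule.dense_iff_topologicalClosure_eq_top).2 hv
  have hb : ∃ C, ∀ a, ‖f a‖ ≤ C * ‖e a‖ := ⟨1, fun a => by rw [one_mul, hn]⟩
  have hU : ∀ a, f.extendOfNorm e (e a) = f a := LinearMap.extendOfNorm_eq hdense hb
  refine ⟨⟨(f.extendOfNorm e).toLinearMap, fun x => ?_⟩, fun i => ?_⟩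
  · refine hdense.induction_on (p := fun x => ‖f.extendOfNorm e x‖ = ‖x‖) x
      (isClosed_eq (by fun_prop) (by fun_prop)) fun a => ?_
    rw [hU, hn]
  · have := hU (Finsupp.single i 1)
    simpa [e, f] using this

/-- Two families with the same Gram matrix are related by a partial isometry whose initial space
is the closed span of the first. -/
theorem exists_partialIsometry_of_gram [CompleteSpace E] {v w : I → E}
    (h : ∀ i j, inner ℂ (w i) (w j) = inner ℂ (v i) (v j)) :
    ∃ C : E →L[ℂ] E, (∀ i, C (v i) = w i) ∧ (∀ i, ContinuousLinearMap.adjoint C (w i) = v i) ∧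
      ∀ x, (∀ i, inner ℂ (v i) x = 0) → C x = 0 := by
  set M := (Submodule.span ℂ (Set.range v)).topologicalClosure with hM
  have hvM : ∀ i, v i ∈ M := fun i =>
    Submodule.le_topologicalClosure _ (Submodule.subset_span ⟨i, rfl⟩)
  have : CompleteSpace M := (Submodule.isClosed_topologicalClosure _).completeSpace_coe
  let v' : I → M := fun i => ⟨v i, hvM i⟩
  have hv' : (Submodule.span ℂ (Set.range v')).topologicalClosure = ⊤ := by
    rw [Submodule.topologicalClosure_eq_top_iff, Submodule.eq_bot_iff]
    intro x hx
    have hx' : ∀ i, inner ℂ (v i) (x : E) = 0 := fun i =>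
      (Submodule.mem_orthogonal _ _).1 hx (v' i) (Submodule.subset_span ⟨i, rfl⟩)
    have h1 : M ≤ (ℂ ∙ (x : E))ᗮ := by
      refine Submodule.topologicalClosure_minimal _ (Submodule.span_le.2 ?_)
        (Submodule.isClosed_orthogonal _)
      rintro _ ⟨i, rfl⟩
      rw [SetLike.mem_coe, Submodule.mem_orthogonal_singleton_iff_inner_left]
      exact hx' i
    have h2 := Submodule.mem_orthogonal_singleton_iff_inner_left.1 (h1 x.2)
    exact Subtype.ext (inner_self_eq_zero.1 h2)
  obtain ⟨U, hU⟩ := exists_linearIsometry_of_gram (F := E) (w := w) hv' h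
  have hP : ∀ i, M.orthogonalProjectionOnto (v i) = v' i := fun i =>
    Submodule.orthogonalProjectionOnto_mem_subspace_eq_self (v' i)
  refine ⟨U.toContinuousLinearMap.comp M.orthogonalProjectionOnto, fun i => ?_, fun i => ?_,
    fun x hx => ?_⟩
  · simp [hP, hU]
  · refine ext_inner_left ℂ fun y => ?_
    rw [ContinuousLinearMap.adjoint_inner_right, ← hU i]
    simp only [ContinuousLinearMap.comp_apply, LinearIsometry.coe_toContinuousLinearMap,
      LinearIsometry.inner_map_map]
    exact Submodule.inner_orthogonalProjectionOnto_eq_of_mem_right (v' i) y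
  · have h1 : x ∈ Mᗮ := by
      rw [Submodule.orthogonal_closure, Submodule.mem_orthogonal]
      intro y hy
      induction hy using Submodule.span_induction with
      | mem y hy => obtain ⟨i, rfl⟩ := hy; exact hx i
      | zero => simp
      | add y z _ _ hy hz => rw [inner_add_left, hy, hz, add_zero]
      | smul t y _ hy => rw [inner_smul_left, hy, mul_zero]
    simp [Submodule.orthogonalProjectionOnto_apply_of_mem_orthogonal h1]

lemma eq_zero_of_apply_family_eq_zero [CompleteSpace E] {v : I → E} {A : E →L[ℂ] F}
    (h1 : ∀ i, A (v i) = 0) (h2 : ∀ x, (∀ i, inner ℂ (v i) x = 0) → A x = 0) : A = 0 := by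
  set M := (Submodule.span ℂ (Set.range v)).topologicalClosure with hM
  have : CompleteSpace M := (Submodule.isClosed_topologicalClosure _).completeSpace_coe
  have hA : M ≤ LinearMap.ker A.toLinearMap :=
    Submodule.topologicalClosure_minimal _
      (Submodule.span_le.2 (by rintro _ ⟨i, rfl⟩; exact h1 i)) A.isClosed_ker
  ext x
  have hx : A (M.starProjection x) = 0 := hA (by simp)
  have hx' : A (x - M.starProjection x) = 0 := by
    refine h2 _ fun i => ?_
    have h3 : x - M.starProjection x ∈ Mᗮ := Submodule.sub_starProjection_mem_orthogonal x
    exact (Submodule.mem_orthogonal _ _).1 h3 _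
      (Submodule.le_topologicalClosure _ (Submodule.subset_span ⟨i, rfl⟩))
  rw [map_sub, hx, sub_zero] at hx'
  simpa using hx'

variable {J H : Type*} [NormedAddCommGroup H] [InnerProductSpace ℂ H] [CompleteSpace H]

/-- A family of vectors indexed by pairs whose Gram matrix is the product of the Gram matrices of two
total families extends to an isometric bilinear map, a Hilbert tensor product. -/
theorem exists_bilinear_of_gram {v : I → E} {w : J → F} {t : I → J → H}
    (hv : (Submodule.span ℂ (Set.range v)).topologicalClosure = ⊤)
    (hw : (Submodule.span ℂ (Set.range w)).topologicalClosure = ⊤)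
    (h : ∀ i j i' j', inner ℂ (t i j) (t i' j') = inner ℂ (v i) (v i') * inner ℂ (w j) (w j')) :
    ∃ B : E →L[ℂ] F →L[ℂ] H, (∀ i j, B (v i) (w j) = t i j) ∧
      ∀ x y x' y', inner ℂ (B x y) (B x' y') = inner ℂ x x' * inner ℂ y y' := by
  let p : I × J → E ⊗[ℂ] F := fun ij => v ij.1 ⊗ₜ w ij.2
  have hp : (Submodule.span ℂ (Set.range p)).topologicalClosure = ⊤ := by
    set S := (Submodule.span ℂ (Set.range p)).topologicalClosure with hS
    have hSc : IsClosed (S : Set (E ⊗[ℂ] F)) := Submodule.isClosed_topologicalClosure _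
    have h1 : ∀ x j, x ⊗ₜ[ℂ] w j ∈ S := fun x j =>
      mem_of_dense_span hv (S := S.comap ((TensorProduct.mkL ℂ E F).flip (w j)).toLinearMap)
        (hSc.preimage ((TensorProduct.mkL ℂ E F).flip (w j)).continuous)
        (fun i => Submodule.le_topologicalClosure _ (Submodule.subset_span ⟨(i, j), rfl⟩)) x
    have h2 : ∀ x y, x ⊗ₜ[ℂ] y ∈ S := fun x y =>
      mem_of_dense_span hw (S := S.comap (TensorProduct.mkL ℂ E F x).toLinearMap)
        (hSc.preimage (TensorProduct.mkL ℂ E F x).continuous) (h1 x) y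
    rw [eq_top_iff, ← TensorProduct.span_tmul_eq_top, Submodule.span_le]
    rintro _ ⟨x, y, rfl⟩
    exact h2 x y
  obtain ⟨U, hU⟩ := exists_linearIsometry_of_gram (v := p) (w := fun ij : I × J => t ij.1 ij.2) hp
    (fun i j => by rw [h, TensorProduct.inner_tmul])
  refine ⟨(ContinuousLinearMap.compL ℂ F (E ⊗[ℂ] F) H U.toContinuousLinearMap).comp
    (TensorProduct.mkL ℂ E F), fun i j => hU (i, j), fun x y x' y' => ?_⟩
  change inner ℂ (U (x ⊗ₜ y)) (U (x' ⊗ₜ y')) = _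
  rw [LinearIsometry.inner_map_map, TensorProduct.inner_tmul]

end Gram

/-! ### Hilbert–Schmidt operators as vectors of a tensor product -/

section HilbertSchmidt

variable {K H : Type*} [NormedAddCommGroup K] [InnerProductSpace ℂ K] [CompleteSpace K]
  [NormedAddCommGroup H] [InnerProductSpace ℂ H] [CompleteSpace H]

/-- The operator with matrix elements `⟨x, T y⟩ = ⟨B x (J y), Ψ⟩`. For a tensor product `B` of `K` with
itself and a conjugation `J`, this identifies `H` with the Hilbert–Schmidt operators on `K`. -/
def opOf (B : K →L[ℂ] K →L[ℂ] H) (J : K ≃ₗᵢ⋆[ℂ] K) (Ψ : H) : K →L[ℂ] K :=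
  LinearMap.mkContinuous
    { toFun := fun y => ContinuousLinearMap.adjoint (B.flip (J y)) Ψ
      map_add' := fun y z => by simp
      map_smul' := fun t y => by simp [map_smulₛₗ] }
    (‖B.flip‖ * ‖Ψ‖) fun y => by
      refine (ContinuousLinearMap.le_opNorm (ContinuousLinearMap.adjoint (B.flip (J y))) Ψ).trans ?_
      rw [LinearIsometryEquiv.norm_map]
      calc ‖B.flip (J y)‖ * ‖Ψ‖ ≤ (‖B.flip‖ * ‖J y‖) * ‖Ψ‖ := by
            gcongr; exact ContinuousLinearMap.le_opNorm _ _
        _ = ‖B.flip‖ * ‖Ψ‖ * ‖y‖ := by rw [LinearIsometryEquiv.norm_map]; ring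

variable {B : K →L[ℂ] K →L[ℂ] H} {J : K ≃ₗᵢ⋆[ℂ] K}

lemma inner_opOf (Ψ : H) (x y : K) :
    inner ℂ x (opOf B J Ψ y) = inner ℂ (B x (J y)) Ψ := by
  change inner ℂ x (ContinuousLinearMap.adjoint (B.flip (J y)) Ψ) = _
  rw [ContinuousLinearMap.adjoint_inner_right]
  rfl

lemma adjoint_opOf_apply (hJ : ∀ x y, inner ℂ (J x) (J y) = inner ℂ y x) (Ψ : H) (x : K) :
    ContinuousLinearMap.adjoint (opOf B J Ψ) x
      = J.symm (ContinuousLinearMap.adjoint (B x) Ψ) := by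
  refine ext_inner_left ℂ fun y => ?_
  rw [ContinuousLinearMap.adjoint_inner_right, ← inner_conj_symm, inner_opOf, inner_conj_symm,
    ← hJ, LinearIsometryEquiv.apply_symm_apply, ContinuousLinearMap.adjoint_inner_left]

lemma inner_opOf_comp_adjoint (hJ : ∀ x y, inner ℂ (J x) (J y) = inner ℂ y x) (Ψ : H) (x y : K) :
    inner ℂ x ((opOf B J Ψ ∘L ContinuousLinearMap.adjoint (opOf B J Ψ)) y)
      = inner ℂ Ψ (B y (ContinuousLinearMap.adjoint (B x) Ψ)) := by
  rw [ContinuousLinearMap.comp_apply, ← ContinuousLinearMap.adjoint_inner_left,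
    adjoint_opOf_apply hJ, adjoint_opOf_apply hJ, ← hJ]
  simp only [LinearIsometryEquiv.apply_symm_apply]
  rw [ContinuousLinearMap.adjoint_inner_left]

/-- The product basis of a Hilbert tensor product. -/
theorem exists_hilbertBasis_bilinear
    (hB : ∀ x y x' y', inner ℂ (B x y) (B x' y') = inner ℂ x x' * inner ℂ y y')
    (hdense : ∀ Ψ : H, (∀ x y, inner ℂ (B x y) Ψ = 0) → Ψ = 0)
    (hJ : ∀ x y, inner ℂ (J x) (J y) = inner ℂ y x) {s : Type*} (e : HilbertBasis s ℂ K) :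
    ∃ b : HilbertBasis (s × s) ℂ H, ∀ i j, b (i, j) = B (e i) (J (e j)) := by
  classical
  have hortho : Orthonormal ℂ fun ij : s × s => B (e ij.1) (J (e ij.2)) := by
    rw [orthonormal_iff_ite]
    rintro ⟨i, j⟩ ⟨i', j'⟩
    rw [hB, hJ, orthonormal_iff_ite.1 e.orthonormal, orthonormal_iff_ite.1 e.orthonormal]
    simp only [Prod.mk.injEq, ite_and, eq_comm (a := j')]
    split_ifs <;> simp
  have hbot : (Submodule.span ℂ (Set.range fun ij : s × s => B (e ij.1) (J (e ij.2))))ᗮ = ⊥ := by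
    rw [Submodule.eq_bot_iff]
    intro Ψ hΨ
    have h0 : ∀ i j, inner ℂ (e i) (opOf B J Ψ (e j)) = 0 := fun i j => by
      rw [inner_opOf]
      exact (Submodule.mem_orthogonal _ _).1 hΨ _ (Submodule.subset_span ⟨(i, j), rfl⟩)
    have h1 : ∀ j, opOf B J Ψ (e j) = 0 := fun j => by
      have hs := e.hasSum_repr (opOf B J Ψ (e j))
      simp only [e.repr_apply_apply, h0, zero_smul] at hs
      exact hs.unique hasSum_zero
    have h2 : ∀ y, opOf B J Ψ y = 0 := fun y =>
      mem_of_dense_span e.dense_span (S := LinearMap.ker (opOf B J Ψ).toLinearMap)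
        (opOf B J Ψ).isClosed_ker h1 y
    refine hdense Ψ fun x y => ?_
    rw [← J.apply_symm_apply y, ← inner_opOf, h2, inner_zero_right]
  exact ⟨HilbertBasis.mkOfOrthogonalEqBot hortho hbot, fun i j => by simp⟩

/-- Reduction of a vector state to the first tensor factor: an operator `V` on `H` that acts as `U` on
the first factor has in `Ψ` the expectation value `Tr (T T† U)`, `T` the operator of `Ψ`. -/
theorem hasTrace_opOf
    (hB : ∀ x y x' y', inner ℂ (B x y) (B x' y') = inner ℂ x x' * inner ℂ y y')
    (hdense : ∀ Ψ : H, (∀ x y, inner ℂ (B x y) Ψ = 0) → Ψ = 0)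
    (hJ : ∀ x y, inner ℂ (J x) (J y) = inner ℂ y x) {U : K →L[ℂ] K} {V : H →L[ℂ] H}
    (hUV : ∀ x y, B (U x) y = V (B x y)) (Ψ : H) :
    HasTrace ((opOf B J Ψ ∘L ContinuousLinearMap.adjoint (opOf B J Ψ)) ∘L U)
      (inner ℂ Ψ (V Ψ)) := by
  intro s e
  obtain ⟨b, hb⟩ := exists_hilbertBasis_bilinear hB hdense hJ e
  set T := opOf B J Ψ with hT
  have hsum := b.hasSum_inner_mul_inner (ContinuousLinearMap.adjoint V Ψ) Ψ
  rw [ContinuousLinearMap.adjoint_inner_left] at hsum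
  refine hsum.prod_fiberwise fun i => ?_
  have hi := e.hasSum_inner_mul_inner (ContinuousLinearMap.adjoint T (e i))
    (ContinuousLinearMap.adjoint T (U (e i)))
  rw [ContinuousLinearMap.adjoint_inner_left] at hi
  change HasSum _ (inner ℂ (e i) (T (ContinuousLinearMap.adjoint T (U (e i)))))
  refine hi.congr_fun fun j => ?_
  rw [hb, ContinuousLinearMap.adjoint_inner_left, ContinuousLinearMap.adjoint_inner_left,
    ContinuousLinearMap.adjoint_inner_right, ← hUV, hT, inner_opOf, ← inner_conj_symm Ψ,
    ← inner_opOf, inner_conj_symm, mul_comm]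

/-- Every Hilbert–Schmidt operator on `K` is the operator of a vector of `H`. -/
theorem exists_opOf_eq
    (hB : ∀ x y x' y', inner ℂ (B x y) (B x' y') = inner ℂ x x' * inner ℂ y y')
    (hdense : ∀ Ψ : H, (∀ x y, inner ℂ (B x y) Ψ = 0) → Ψ = 0)
    (hJ : ∀ x y, inner ℂ (J x) (J y) = inner ℂ y x) (S : K →L[ℂ] K) {s : Type*}
    (e : HilbertBasis s ℂ K) (hS : Summable fun j => ‖S (e j)‖ ^ 2) :
    ∃ Φ : H, opOf B J Φ = S := by
  obtain ⟨b, hb⟩ := exists_hilbertBasis_bilinear hB hdense hJ e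
  have hrow : ∀ j, HasSum (fun i => ‖inner ℂ (e i) (S (e j))‖ ^ 2) (‖S (e j)‖ ^ 2) := by
    intro j
    have h1 := e.hasSum_inner_mul_inner (S (e j)) (S (e j))
    rw [inner_self_eq_norm_sq_to_K] at h1
    have h2 := Complex.hasSum_re h1
    norm_cast at h2
    change HasSum _ (‖S (e j)‖ ^ 2) at h2
    convert h2 using 2 with i
    rw [← inner_conj_symm, Complex.mul_conj, Complex.ofReal_re, Complex.normSq_eq_norm_sq,
      RCLike.norm_conj]
  have hsum : Summable fun p : s × s => ‖inner ℂ (e p.1) (S (e p.2))‖ ^ 2 := by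
    have h1 : Summable fun p : s × s => ‖inner ℂ (e p.2) (S (e p.1))‖ ^ 2 := by
      rw [summable_prod_of_nonneg (fun p => sq_nonneg _)]
      exact ⟨fun j => (hrow j).summable, by simpa only [(hrow _).tsum_eq] using hS⟩
    exact (Equiv.prodComm s s).summable_iff.1 h1
  have hmem : Memℓp (fun p : s × s => inner ℂ (e p.1) (S (e p.2))) 2 :=
    memℓp_gen (by simpa using hsum)
  refine ⟨b.repr.symm ⟨_, hmem⟩, ?_⟩
  have h1 : ∀ i j, inner ℂ (e i) (opOf B J (b.repr.symm ⟨_, hmem⟩) (e j))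
      = inner ℂ (e i) (S (e j)) := by
    intro i j
    rw [inner_opOf, ← hb, ← b.repr_apply_apply, LinearIsometryEquiv.apply_symm_apply]
  have h2 : ∀ j, opOf B J (b.repr.symm ⟨_, hmem⟩) (e j) = S (e j) := fun j =>
    e.repr.injective (by ext i; simp only [e.repr_apply_apply, h1])
  ext y
  rw [← sub_eq_zero, ← sub_apply]
  exact mem_of_dense_span e.dense_span
    (S := LinearMap.ker (opOf B J (b.repr.symm ⟨_, hmem⟩) - S).toLinearMap)
    (opOf B J (b.repr.symm ⟨_, hmem⟩) - S).isClosed_ker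
    (fun j => by simp [h2]) y

/-- A density operator has a Hilbert–Schmidt square root. -/
lemma exists_sqrt_of_hasTrace_one {ρ : K →L[ℂ] K} (hρ : ρ.IsPositive) (htr : HasTrace ρ 1)
    {s : Set K} (e : HilbertBasis s ℂ K) :
    ∃ S : K →L[ℂ] K, ρ = S ∘L ContinuousLinearMap.adjoint S ∧
      Summable fun j => ‖S (e j)‖ ^ 2 := by
  have h0 : 0 ≤ ρ := (ContinuousLinearMap.nonneg_iff_isPositive ρ).2 hρ
  have hs : CFC.sqrt ρ * CFC.sqrt ρ = ρ := CFC.sqrt_mul_sqrt_self ρ h0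
  have hsa : ContinuousLinearMap.adjoint (CFC.sqrt ρ) = CFC.sqrt ρ :=
    (ContinuousLinearMap.nonneg_iff_isPositive _ |>.1 (CFC.sqrt_nonneg ρ)).isSelfAdjoint.adjoint_eq
  refine ⟨CFC.sqrt ρ, by rw [hsa]; exact hs.symm, ?_⟩
  have h1 := Complex.hasSum_re (htr s e)
  refine h1.summable.congr fun j => ?_
  conv_lhs => rw [← hs]
  rw [mul_apply_eq_comp, ← ContinuousLinearMap.adjoint_inner_left, hsa, inner_self_eq_norm_sq_to_K]
  norm_cast

variable {Z : Type*} [AddGroup Z]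

/-- Two vectors with the same expectation values of projective unitary operators `V z` that act as
an irreducible family `U z` on the first tensor factor have the same reduction to that factor.
The partial isometry that maps `V z Φ` to `V z Ψ` acts, by irreducibility, on the second factor only,
so the reduction does not see it. -/
theorem opOf_comp_adjoint_eq_of_inner_eq
    (hB : ∀ x y x' y', inner ℂ (B x y) (B x' y') = inner ℂ x x' * inner ℂ y y')
    (hdense : ∀ Ψ : H, (∀ x y, inner ℂ (B x y) Ψ = 0) → Ψ = 0)
    (hJ : ∀ x y, inner ℂ (J x) (J y) = inner ℂ y x)
    {U : Z → K →L[ℂ] K} {V : Z → H →L[ℂ] H} {φ : Z → Z → ℂ}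
    (hUV : ∀ z x y, B (U z x) y = V z (B x y))
    (hV : ∀ z w, V z * V w = φ z w • V (z + w))
    (hV0 : V 0 = 1)
    (hVadj : ∀ z, ContinuousLinearMap.adjoint (V z) = V (-z))
    (hUadj : ∀ z, ContinuousLinearMap.adjoint (U z) = U (-z))
    (hirr : ∀ D : K →L[ℂ] K, (∀ z, D * U z = U z * D) → ∃ c : ℂ, D = c • 1)
    {Φ Ψ : H} (h : ∀ z, inner ℂ Φ (V z Φ) = inner ℂ Ψ (V z Ψ)) :
    opOf B J Φ ∘L ContinuousLinearMap.adjoint (opOf B J Φ)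
      = opOf B J Ψ ∘L ContinuousLinearMap.adjoint (opOf B J Ψ) := by
  have hVV : ∀ z w x, V z (V w x) = φ z w • V (z + w) x := fun z w x => by
    rw [← mul_apply_eq_comp, hV]; rfl
  have hgram : ∀ Θ z w, inner ℂ (V z Θ) (V w Θ) = φ (-z) w * inner ℂ Θ (V (-z + w) Θ) := by
    intro Θ z w
    rw [← ContinuousLinearMap.adjoint_inner_right, hVadj, hVV, inner_smul_right]
  obtain ⟨C, hC, hCadj, hC0⟩ := exists_partialIsometry_of_gram (v := fun z => V z Φ)
    (w := fun z => V z Ψ) fun z w => by rw [hgram, hgram, h]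
  have hCΦ : C Φ = Ψ := by simpa [hV0] using hC 0
  have hCΨ : ContinuousLinearMap.adjoint C Ψ = Φ := by simpa [hV0] using hCadj 0
  have hcomm : ∀ z x, C (V z x) = V z (C x) := by
    intro z x
    have h0 : C * V z - V z * C = 0 := by
      refine eq_zero_of_apply_family_eq_zero (v := fun w => V w Φ) (fun w => ?_) fun y hy => ?_
      · simp only [sub_apply, mul_apply_eq_comp, hVV, map_smul, hC, sub_self]
      · have h1 : C (V z y) = 0 := by
          refine hC0 _ fun w => ?_
          rw [← ContinuousLinearMap.adjoint_inner_left, hVadj, hVV, inner_smul_left, hy, mul_zero]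
        simp only [sub_apply, mul_apply_eq_comp, h1, hC0 y hy, map_zero, sub_zero]
    have h1 := congrArg (fun A : H →L[ℂ] H => A x) h0
    simpa [sub_eq_zero] using h1
  -- `C` acts on the second factor only
  have hscalar : ∀ y y', ∃ c : ℂ, ∀ x x',
      inner ℂ (B x y) (C (B x' y')) = c * inner ℂ x x' := by
    intro y y'
    obtain ⟨c, hc⟩ := hirr (ContinuousLinearMap.adjoint (B.flip y) ∘L C ∘L B.flip y') fun z => by
      ext x'
      refine ext_inner_left ℂ fun x => ?_
      simp only [mul_apply_eq_comp, ContinuousLinearMap.comp_apply]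
      rw [ContinuousLinearMap.adjoint_inner_right, ← ContinuousLinearMap.adjoint_inner_left (U z),
        ContinuousLinearMap.adjoint_inner_right, hUadj]
      simp only [ContinuousLinearMap.flip_apply]
      rw [hUV, hUV, hcomm, ← hVadj, ContinuousLinearMap.adjoint_inner_left]
    refine ⟨c, fun x x' => ?_⟩
    have h1 := congrArg (fun A : K →L[ℂ] K => inner ℂ x (A x')) hc
    simp only [ContinuousLinearMap.comp_apply, smul_apply, one_apply_eq_self, inner_smul_right] at h1
    rw [ContinuousLinearMap.adjoint_inner_right] at h1
    exact h1
  have hext : ∀ a b : H, (∀ x y, inner ℂ (B x y) a = inner ℂ (B x y) b) → a = b := fun a b hab =>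
    sub_eq_zero.1 (hdense _ fun x y => by rw [inner_sub_right, hab, sub_self])
  have hadj : ∀ x u y, ContinuousLinearMap.adjoint (B x) (B u y) = inner ℂ x u • y := by
    intro x u y
    refine ext_inner_left ℂ fun w => ?_
    rw [ContinuousLinearMap.adjoint_inner_right, hB, inner_smul_right]
  ext x
  refine ext_inner_left ℂ fun x' => ?_
  rw [inner_opOf_comp_adjoint hJ, inner_opOf_comp_adjoint hJ]
  -- `B x ∘ (B x')†` acts on the first factor only, as `|x⟩⟨x'|`
  have hL : C ∘L (B x ∘L ContinuousLinearMap.adjoint (B x'))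
      = (B x ∘L ContinuousLinearMap.adjoint (B x')) ∘L C := by
    have key : ∀ w y' u y, inner ℂ (B w y') (C (B x (ContinuousLinearMap.adjoint (B x') (B u y))))
        = inner ℂ (B w y') (B x (ContinuousLinearMap.adjoint (B x') (C (B u y)))) := by
      intro w y' u y
      obtain ⟨c, hc⟩ := hscalar y' y
      rw [hadj, map_smul, map_smul, inner_smul_right, hc,
        ← ContinuousLinearMap.adjoint_inner_left (B x), hadj,
        ContinuousLinearMap.adjoint_inner_right, map_smul, inner_smul_left, inner_conj_symm, hc]
      ring
    have h1 : ∀ u y, C (B x (ContinuousLinearMap.adjoint (B x') (B u y)))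
        = B x (ContinuousLinearMap.adjoint (B x') (C (B u y))) := fun u y =>
      hext _ _ fun w y' => key w y' u y
    have h2 := eq_zero_of_apply_family_eq_zero (v := fun p : K × K => B p.1 p.2)
      (A := C ∘L (B x ∘L ContinuousLinearMap.adjoint (B x'))
        - (B x ∘L ContinuousLinearMap.adjoint (B x')) ∘L C)
      (fun p => by simp [h1]) (fun a ha => by rw [hdense a fun x y => ha (x, y), map_zero])
    exact sub_eq_zero.1 h2
  have hLΦ := congrArg (fun A : H →L[ℂ] H => inner ℂ Ψ (A Φ)) hL
  simp only [ContinuousLinearMap.comp_apply, hCΦ] at hLΦ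
  rw [← hLΦ, ← ContinuousLinearMap.adjoint_inner_left C, hCΨ]

end HilbertSchmidt

/-! ### Irreducibility of the Weyl operators -/

section Irreducible

variable {κ : Type*}

/-- A function that is both holomorphic and antiholomorphic is constant. -/
lemma eq_of_differentiable_of_differentiable_conj {f g : ℂ → ℂ} (hf : Differentiable ℂ f)
    (hg : Differentiable ℂ g) (hfg : ∀ t, conj (f t) = g t) (s t : ℂ) : f s = f t := by
  refine is_const_of_deriv_eq_zero hf (fun x => ?_) s t
  have h1 := (hf x).hasDerivAt.hasFDerivAt.restrictScalars ℝ
  have h2 := (hg x).hasDerivAt.hasFDerivAt.restrictScalars ℝ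
  have h3 := Complex.conjCLE.toContinuousLinearMap.hasFDerivAt.comp x h1
  have h4 : (⇑Complex.conjCLE.toContinuousLinearMap ∘ f) = g := funext hfg
  rw [h4] at h3
  have h5 := h3.unique h2
  have e1 := congrArg (fun L : ℂ →L[ℝ] ℂ => L 1) h5
  have e2 := congrArg (fun L : ℂ →L[ℝ] ℂ => L Complex.I) h5
  simp at e1 e2
  rw [← e1] at e2
  have h6 : conj (deriv f x) = 0 := by
    have : (2 * Complex.I) * conj (deriv f x) = 0 := by linear_combination -e2
    simpa using this
  simpa using h6

lemma sq_norm_expVec_smul (v : ℝ≥0) (r : κ →₀ ℂ) (t : ℂ) :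
    ‖expVec v (t • r)‖ ^ 2 = (Complex.exp (v * (conj t * t * dot (conjVec r) r))).re := by
  have h := inner_self_eq_norm_sq_to_K (𝕜 := ℂ) (expVec v (t • r))
  rw [inner_expVec, conjVec_smul, dot_smul_left, Finsupp.coe_smul, dot_smul_right] at h
  rw [mul_assoc, h]
  norm_cast

/-- `⟨y, E(t r)⟩` is holomorphic in `t`: it is a locally uniform limit of the entire functions that
belong to `y` in the span of the exponential vectors. -/
lemma differentiable_inner_expVec_smul (v : ℝ≥0) (r : κ →₀ ℂ) (y : Lp ℂ 2 (gauss κ v)) :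
    Differentiable ℂ fun t : ℂ => inner ℂ y (expVec v (t • r)) := by
  set S := Submodule.span ℂ (Set.range (expVec (κ := κ) v)) with hS
  have hspan : ∀ y ∈ S, Differentiable ℂ fun t : ℂ => inner ℂ y (expVec v (t • r)) := by
    intro y hy
    induction hy using Submodule.span_induction with
    | mem y hy =>
      obtain ⟨c, rfl⟩ := hy
      simp only [inner_expVec, Finsupp.coe_smul, dot_smul_right]
      fun_prop
    | zero => simp
    | add y z _ _ hy hz => simp only [inner_add_left]; exact hy.add hz
    | smul a y _ hy => simp only [inner_smul_left]; exact hy.const_mul _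
  have hy : y ∈ closure (S : Set (Lp ℂ 2 (gauss κ v))) := by
    rw [← Submodule.topologicalClosure_coe, span_expVec_dense]; trivial
  have : (nhdsWithin y (S : Set (Lp ℂ 2 (gauss κ v)))).NeBot := mem_closure_iff_nhdsWithin_neBot.1 hy
  intro t₀
  obtain ⟨M, hM⟩ : ∃ M, ∀ t ∈ Metric.closedBall t₀ 1, ‖expVec v (t • r)‖ ≤ M := by
    have hc : Continuous fun t : ℂ => ‖expVec v (t • r)‖ := by
      have : (fun t : ℂ => ‖expVec v (t • r)‖)
          = fun t => √((Complex.exp (v * (conj t * t * dot (conjVec r) r))).re) := by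
        ext t
        rw [← sq_norm_expVec_smul, Real.sqrt_sq (norm_nonneg _)]
      rw [this]
      fun_prop
    obtain ⟨M, hM⟩ := (isCompact_closedBall t₀ 1).bddAbove_image hc.continuousOn
    exact ⟨M, fun t ht => hM ⟨t, ht, rfl⟩⟩
  have hM0 : 0 ≤ M := (norm_nonneg _).trans (hM t₀ (by simp))
  have hlim : TendstoUniformlyOn (fun y' t => inner ℂ y' (expVec v (t • r)))
      (fun t => inner ℂ y (expVec v (t • r)))
      (nhdsWithin y (S : Set (Lp ℂ 2 (gauss κ v)))) (Metric.ball t₀ 1) := by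
    rw [Metric.tendstoUniformlyOn_iff]
    intro ε hε
    have h1 : ∀ᶠ y' in nhdsWithin y (S : Set (Lp ℂ 2 (gauss κ v))), dist y' y < ε / (M + 1) :=
      nhdsWithin_le_nhds (Metric.ball_mem_nhds y (by positivity))
    filter_upwards [h1] with y' hy' t ht
    rw [dist_eq_norm, ← inner_sub_left]
    calc ‖inner ℂ (y - y') (expVec v (t • r))‖ ≤ ‖y - y'‖ * ‖expVec v (t • r)‖ :=
          norm_inner_le_norm _ _
      _ ≤ (ε / (M + 1)) * M := by
          rw [dist_eq_norm, norm_sub_rev] at hy'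
          exact mul_le_mul hy'.le (hM t (Metric.ball_subset_closedBall ht)) (norm_nonneg _)
            (by positivity)
      _ < ε := by
          rw [div_mul_eq_mul_div, div_lt_iff₀ (by positivity)]
          nlinarith
  have hd := hlim.tendstoLocallyUniformlyOn.differentiableOn
    (Filter.eventually_of_mem self_mem_nhdsWithin fun y' hy' => (hspan y' hy').differentiableOn)
    Metric.isOpen_ball
  exact hd.differentiableAt (Metric.ball_mem_nhds t₀ one_pos)

lemma weylOp_expVec_zero (v : ℝ≥0) (z : κ →₀ ℂ) :
    weylOp v z (expVec v 0) = weylPhase v z 0 • expVec v z := by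
  rw [weylOp_expVec, zero_add]

/-- The Weyl operators act irreducibly: a bounded operator that commutes with all of them is a
scalar. The matrix element `⟨E₀, D E(t r)⟩`, `r` real, is holomorphic in `t`; by commutation it is
also antiholomorphic, hence constant, which shows that `E₀` is an eigenvector. -/
theorem exists_eq_smul_one_of_commute_weylOp (v : ℝ≥0)
    (D : Lp ℂ 2 (gauss κ v) →L[ℂ] Lp ℂ 2 (gauss κ v))
    (hD : ∀ z, D * weylOp v z = weylOp v z * D) : ∃ c : ℂ, D = c • 1 := by
  have hD' : ∀ z x, D (weylOp v z x) = weylOp v z (D x) := fun z x => by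
    rw [← mul_apply_eq_comp, hD, mul_apply_eq_comp]
  have hphase : ∀ z : κ →₀ ℂ, conj (weylPhase v z 0) = weylPhase v (-z) 0 := by
    intro z
    simp only [weylPhase, ← Complex.exp_conj, map_neg, map_mul, map_div₀, map_ofNat,
      Complex.conj_ofReal, conj_dot', Finsupp.coe_zero, dot_zero_right, mul_zero,
      sub_zero, conjVec_conjVec, conjVec_neg, dot_neg_left, Finsupp.coe_neg, dot_neg_right, neg_neg]
    rw [dot_comm]
  have key : ∀ z, inner ℂ (expVec v z) (D (expVec v 0))
      = inner ℂ (expVec v 0) (D (expVec v (-z))) := by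
    intro z
    have h1 : inner ℂ (weylOp v z (expVec v 0)) (D (expVec v 0))
        = inner ℂ (expVec v 0) (D (weylOp v (-z) (expVec v 0))) := by
      rw [hD', ← adjoint_weylOp, ContinuousLinearMap.adjoint_inner_right]
    rw [weylOp_expVec_zero, weylOp_expVec_zero, map_smul, inner_smul_left, inner_smul_right,
      hphase] at h1
    exact mul_left_cancel₀ (weylPhase_ne_zero v (-z) 0) h1
  set c := inner ℂ (expVec v 0) (D (expVec v (0 : κ →₀ ℂ))) with hc
  have hconst : ∀ (r : κ →₀ ℂ) (t : ℂ), conjVec r = r →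
      inner ℂ (expVec v (t • r)) (D (expVec v 0)) = c := by
    intro r t hr
    have hg : Differentiable ℂ fun t : ℂ => inner ℂ (D (expVec v 0)) (expVec v (t • r)) :=
      differentiable_inner_expVec_smul v r _
    have hf : Differentiable ℂ fun t : ℂ => inner ℂ (expVec v (t • r)) (D (expVec v 0)) := by
      have h1 := differentiable_inner_expVec_smul v (-r)
        (ContinuousLinearMap.adjoint D (expVec v 0))
      simp only [ContinuousLinearMap.adjoint_inner_left, smul_neg] at h1
      simpa only [key] using h1
    have h2 := eq_of_differentiable_of_differentiable_conj hf hg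
      (fun t => inner_conj_symm _ _) t 0
    simpa using h2
  have hvac : D (expVec v 0) = c • expVec v 0 := by
    rw [← sub_eq_zero]
    refine eq_zero_of_inner_expVec_imagVec fun m => ?_
    have hm : imagVec m = Complex.I • m.mapRange (fun x : ℝ => (x : ℂ)) (by simp) := by
      ext k; simp [mul_comm]
    have h1 : inner ℂ (expVec v (imagVec m)) (expVec v (0 : κ →₀ ℂ)) = 1 := by
      rw [inner_expVec]; simp [dot_zero_right]
    rw [inner_sub_right, inner_smul_right, h1, mul_one, hm, hconst _ _ (by ext k; simp), sub_self]
  refine ⟨c, clm_ext_expVec fun z => ?_⟩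
  have h1 : D (weylOp v z (expVec v 0)) = c • weylOp v z (expVec v 0) := by
    rw [hD', hvac, map_smul]
  rw [weylOp_expVec_zero, map_smul, smul_comm] at h1
  simpa using smul_right_injective _ (weylPhase_ne_zero v z 0) h1

end Irreducible

/-! ### The horizon's Hilbert space as a tensor product -/

section Pair

variable {ι : Type*}

/-- Complex conjugation of wavefunctionals. -/
def conjIso {α : Type*} [MeasurableSpace α] (μ : Measure α) : Lp ℂ 2 μ ≃ₗᵢ⋆[ℂ] Lp ℂ 2 μ where
  toFun F := star F
  invFun F := star F
  left_inv F := star_star F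
  right_inv F := star_star F
  map_add' F G := by
    refine Lp.ext ?_
    filter_upwards [Lp.coeFn_star (F + G), Lp.coeFn_add F G, Lp.coeFn_add (star F) (star G),
      Lp.coeFn_star F, Lp.coeFn_star G] with q h1 h2 h3 h4 h5
    rw [h1, h3, Pi.star_apply, h2, Pi.add_apply, Pi.add_apply, h4, h5, star_add]
    rfl
  map_smul' t F := by
    refine Lp.ext ?_
    filter_upwards [Lp.coeFn_star (t • F), Lp.coeFn_smul t F, Lp.coeFn_star F,
      Lp.coeFn_smul (conj t) (star F)] with q h1 h2 h3 h4
    rw [h1, h4, Pi.star_apply, h2, Pi.smul_apply, Pi.smul_apply, h3, smul_eq_mul, star_mul']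
    rfl
  norm_map' F := by
    change ‖star F‖ = ‖F‖
    rw [Lp.norm_def, Lp.norm_def]
    congr 1
    refine eLpNorm_congr_norm_ae ?_
    filter_upwards [Lp.coeFn_star F] with q hq
    simp [hq]

lemma coeFn_conjIso {α : Type*} [MeasurableSpace α] (μ : Measure α) (F : Lp ℂ 2 μ) :
    conjIso μ F =ᵐ[μ] fun q => conj (F q) := Lp.coeFn_star F

lemma inner_conjIso {α : Type*} [MeasurableSpace α] {μ : Measure α} (F G : Lp ℂ 2 μ) :
    inner ℂ (conjIso μ F) (conjIso μ G) = inner ℂ G F := by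
  rw [L2.inner_def, L2.inner_def]
  refine integral_congr_ae ?_
  filter_upwards [coeFn_conjIso μ F, coeFn_conjIso μ G] with q h1 h2
  rw [h1, h2, RCLike.inner_apply, RCLike.inner_apply, Complex.conj_conj, mul_comm]

/-- The vector on the disjoint union with given components. -/
def sumVec (c d : ι →₀ ℂ) : ι ⊕ ι →₀ ℂ := c.mapDomain Sum.inl + d.mapDomain Sum.inr

@[simp] lemma sumVec_inl (c d : ι →₀ ℂ) (k : ι) : sumVec c d (Sum.inl k) = c k := by
  rw [sumVec, Finsupp.add_apply, Finsupp.mapDomain_apply Sum.inl_injective,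
    Finsupp.mapDomain_of_notMem_range _ _ (by simp), add_zero]

@[simp] lemma sumVec_inr (c d : ι →₀ ℂ) (k : ι) : sumVec c d (Sum.inr k) = d k := by
  rw [sumVec, Finsupp.add_apply, Finsupp.mapDomain_apply Sum.inr_injective,
    Finsupp.mapDomain_of_notMem_range _ _ (by simp), zero_add]

lemma dot_sumVec (c d : ι →₀ ℂ) (p : ι ⊕ ι → ℂ) :
    dot (sumVec c d) p = dot c (fun k => p (Sum.inl k)) + dot d (fun k => p (Sum.inr k)) := by
  rw [sumVec, dot_add_left]
  simp only [dot, Finsupp.linearCombination_mapDomain]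
  rfl

lemma conjVec_sumVec (c d : ι →₀ ℂ) : conjVec (sumVec c d) = sumVec (conjVec c) (conjVec d) := by
  ext (k | k) <;> simp

/-- The exponent on the phase space that corresponds to the exponents `α` of `B₁` and `β` of `B₂` in a
kernel: the Wigner–Weyl transform turns `exp (c_A·A + c_B·B)` times the reference amplitude into
`exp (α·B₁ + β·B₂)` times the reference amplitude, up to normalisation, where
`c_A = i (α - β)` and `c_B = α + β`. -/
def oddVec (α β : ι →₀ ℂ) : ι ⊕ ι →₀ ℂ := sumVec (Complex.I • (α - β)) (α + β)

lemma oddVec_add (α β α' β' : ι →₀ ℂ) :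
    oddVec α β + oddVec α' β' = oddVec (α + α') (β + β') := by
  ext (k | k)
  · simp [oddVec]; ring
  · simp [oddVec]; ring

lemma oddVec_neg (α β : ι →₀ ℂ) : -oddVec α β = oddVec (-α) (-β) := by
  ext (k | k)
  · simp [oddVec]; ring
  · simp [oddVec]; ring

lemma exists_oddVec (c : ι ⊕ ι →₀ ℂ) : ∃ α β, oddVec α β = c := by
  set cA := c.comapDomain Sum.inl Sum.inl_injective.injOn with hA
  set cB := c.comapDomain Sum.inr Sum.inr_injective.injOn with hB
  refine ⟨(1 / 2 : ℂ) • (cB - Complex.I • cA), (1 / 2 : ℂ) • (cB + Complex.I • cA), ?_⟩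
  ext (k | k)
  · simp [oddVec, hA, hB, Finsupp.comapDomain_apply]
    linear_combination (-c (Sum.inl k)) * Complex.I_mul_I
  · simp [oddVec, hA, hB, Finsupp.comapDomain_apply]
    ring

lemma dot_conjVec_oddVec (α β α' β' : ι →₀ ℂ) :
    dot (conjVec (oddVec α β)) (oddVec α' β')
      = 2 * dot (conjVec α) α' + 2 * dot (conjVec β) β' := by
  have h1 : (fun k => oddVec α' β' (Sum.inl k)) = Complex.I • (⇑α' + -⇑β') := by
    ext k; simp [oddVec, mul_add, sub_eq_add_neg]
  have h2 : (fun k => oddVec α' β' (Sum.inr k)) = ⇑α' + ⇑β' := by ext k; simp [oddVec]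
  rw [oddVec, conjVec_sumVec, dot_sumVec, h1, h2, conjVec_smul, conjVec_add, sub_eq_add_neg,
    conjVec_add, conjVec_neg]
  simp only [dot_smul_left, dot_smul_right, dot_add_left, dot_add_right, dot_neg_left,
    dot_neg_right, Complex.conj_I]
  linear_combination (-(dot (conjVec α) α' - dot (conjVec α) β' - dot (conjVec β) α'
    + dot (conjVec β) β')) * Complex.I_mul_I

lemma exists_pairMap (ι : Type*) : ∃ B : HalfSpace ι →L[ℂ] HalfSpace ι →L[ℂ] OddSpace ι,
    (∀ α β : ι →₀ ℂ, B (expVec _ α) (expVec _ β) = expVec _ (oddVec α β)) ∧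
      ∀ x y x' y', inner ℂ (B x y) (B x' y') = inner ℂ x x' * inner ℂ y y' := by
  refine exists_bilinear_of_gram (v := fun α : ι →₀ ℂ => (expVec (1 / 2) α : HalfSpace ι))
    (w := fun β : ι →₀ ℂ => (expVec (1 / 2) β : HalfSpace ι))
    (t := fun α β => (expVec (1 / 4) (oddVec α β) : OddSpace ι))
    (span_expVec_dense ι _) (span_expVec_dense ι _) fun α β α' β' => ?_
  rw [inner_expVec, inner_expVec, inner_expVec, ← Complex.exp_add, dot_conjVec_oddVec]
  congr 1
  push_cast
  ring

/-- The Hilbert tensor product `HalfSpace ⊗ HalfSpace ≅ OddSpace` given by the inverse Wigner–Weyl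
transform of kernels `x(B₁) y(B₂)`, fixed by its values on exponential vectors. -/
def pairMap (ι : Type*) : HalfSpace ι →L[ℂ] HalfSpace ι →L[ℂ] OddSpace ι :=
  (exists_pairMap ι).choose

lemma pairMap_expVec (α β : ι →₀ ℂ) :
    pairMap ι (expVec _ α) (expVec _ β) = expVec _ (oddVec α β) :=
  (exists_pairMap ι).choose_spec.1 α β

lemma inner_pairMap (x y x' y' : HalfSpace ι) :
    inner ℂ (pairMap ι x y) (pairMap ι x' y') = inner ℂ x x' * inner ℂ y y' :=
  (exists_pairMap ι).choose_spec.2 x y x' y'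

lemma eq_zero_of_inner_pairMap (Ψ : OddSpace ι)
    (h : ∀ x y, inner ℂ (pairMap ι x y) Ψ = 0) : Ψ = 0 := by
  refine eq_zero_of_inner_expVec_imagVec fun m => ?_
  obtain ⟨α, β, hαβ⟩ := exists_oddVec (imagVec m)
  rw [← hαβ, ← pairMap_expVec]
  exact h _ _

/-- The Weyl operators on the horizon with `β = 0` act on the first tensor factor, as Weyl operators
on the half-horizon. -/
lemma pairMap_weylOp (z : ι →₀ ℂ) (x y : HalfSpace ι) :
    pairMap ι (weylOp _ z x) y = weylOp _ (oddVec z 0) (pairMap ι x y) := by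
  have h : (pairMap ι).comp (weylOp _ z)
      = (ContinuousLinearMap.compL ℂ _ _ _ (weylOp _ (oddVec z 0))).comp (pairMap ι) := by
    refine clm_ext_expVec fun α => clm_ext_expVec fun β => ?_
    change pairMap ι (weylOp _ z (expVec _ α)) (expVec _ β)
      = weylOp _ (oddVec z 0) (pairMap ι (expVec _ α) (expVec _ β))
    rw [weylOp_expVec, map_smul, smul_apply, pairMap_expVec, pairMap_expVec, weylOp_expVec,
      oddVec_add, add_zero, weylPhase, weylPhase, dot_conjVec_oddVec, dot_conjVec_oddVec,
      conjVec_zero, dot_zero_left, dot_zero_left]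
    congr 2
    push_cast
    ring
  exact congrArg (fun A : HalfSpace ι →L[ℂ] HalfSpace ι →L[ℂ] OddSpace ι => A x y) h

end Pair

/-! ### Symplectic coordinates of half-horizon test functions -/

section Kinematics

variable {X : Type*}

@[fun_prop]
lemma measurable_sign : Measurable Real.sign := by
  unfold Real.sign
  exact Measurable.ite measurableSet_Iio measurable_const
    (Measurable.ite measurableSet_Ioi measurable_const measurable_const)

lemma abs_sign_le_one (r : ℝ) : |Real.sign r| ≤ 1 := by
  rcases Real.sign_apply_eq r with h | h | h <;> simp [h]

/-- The contribution of a single lightray to the commutator form, up to the factor `1/4`. -/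
def rayForm (f g : ℝ × X → ℝ) (x : X) : ℝ :=
  ∫ u : ℝ, f (u, x) * ∫ u' : ℝ, g (u', x) * Real.sign (u' - u)

lemma commForm_eq [MeasurableSpace X] (μ : Measure X) (f g : ℝ × X → ℝ) :
    commForm μ f g = (1 / 4) * ∫ x, rayForm f g x ∂μ := by
  simp only [commForm, rayForm, mul_assoc, integral_const_mul]

lemma rayForm_smul (t : ℝ) (f g : ℝ × X → ℝ) (x : X) :
    rayForm (t • f) g x = t * rayForm f g x := by
  simp only [rayForm, Pi.smul_apply, smul_eq_mul, mul_assoc, integral_const_mul]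

lemma commForm_smul [MeasurableSpace X] (μ : Measure X) (t : ℝ) (f g : ℝ × X → ℝ) :
    commForm μ (t • f) g = t * commForm μ f g := by
  simp only [commForm_eq, rayForm_smul, integral_const_mul]
  ring

variable [TopologicalSpace X]

lemma exists_support_bound {f : ℝ × X → ℝ} (hc : Continuous f) (hf : HasCompactSupport f) :
    ∃ (M R : ℝ) (S : Set X), IsCompact S ∧ 0 ≤ M ∧ 0 ≤ R ∧ (∀ p, |f p| ≤ M) ∧
      ∀ u x, f (u, x) ≠ 0 → u ∈ Set.Icc (-R) R ∧ x ∈ S := by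
  obtain ⟨M, hM⟩ := hc.bounded_above_of_compact_support hf
  obtain ⟨R, hR⟩ := (hf.isCompact.image continuous_fst).isBounded.exists_norm_le
  refine ⟨max M 0, max R 0, Prod.snd '' tsupport f, hf.isCompact.image continuous_snd,
    le_max_right _ _, le_max_right _ _, fun p => (hM p).trans (le_max_left _ _),
    fun u x hux => ?_⟩
  have hmem : (u, x) ∈ tsupport f := subset_tsupport _ hux
  refine ⟨?_, ⟨_, hmem, rfl⟩⟩
  have := (hR u ⟨_, hmem, rfl⟩).trans (le_max_left R 0)
  exact abs_le.1 this

lemma integrable_fiber {f : ℝ × X → ℝ} (hc : Continuous f) (hf : HasCompactSupport f) (x : X) :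
    Integrable fun u : ℝ => f (u, x) := by
  obtain ⟨M, R, S, -, -, -, -, hs⟩ := exists_support_bound hc hf
  refine (by fun_prop : Continuous fun u : ℝ => f (u, x)).integrable_of_hasCompactSupport
    (HasCompactSupport.intro (isCompact_Icc (a := -R) (b := R)) fun u hu => ?_)
  by_contra h
  exact hu (hs u x h).1

lemma integrable_fiber_mul_sign {f : ℝ × X → ℝ} (hc : Continuous f) (hf : HasCompactSupport f)
    (x : X) (u : ℝ) : Integrable fun u' : ℝ => f (u', x) * Real.sign (u' - u) :=
  (integrable_fiber hc hf x).mul_bdd (c := 1)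
    (Measurable.aestronglyMeasurable (by fun_prop))
    (Filter.Eventually.of_forall fun u' => abs_sign_le_one _)

lemma abs_integral_fiber_mul_sign_le {f : ℝ × X → ℝ} (hc : Continuous f) (hf : HasCompactSupport f)
    (x : X) (u : ℝ) :
    |∫ u' : ℝ, f (u', x) * Real.sign (u' - u)| ≤ ∫ u' : ℝ, |f (u', x)| := by
  refine (abs_integral_le_integral_abs).trans
    (integral_mono (integrable_fiber_mul_sign hc hf x u).abs (integrable_fiber hc hf x).abs
      fun u' => ?_)
  simp only [abs_mul]
  exact mul_le_of_le_one_right (abs_nonneg _) (abs_sign_le_one _)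

lemma integrable_ray {f g : ℝ × X → ℝ} (hfc : Continuous f) (hf : HasCompactSupport f)
    (hgc : Continuous g) (hg : HasCompactSupport g) (x : X) :
    Integrable fun u : ℝ => f (u, x) * ∫ u' : ℝ, g (u', x) * Real.sign (u' - u) := by
  have hgm : Measurable fun u : ℝ => g (u, x) := (by fun_prop : Continuous _).measurable
  have hm : StronglyMeasurable fun u : ℝ => ∫ u' : ℝ, g (u', x) * Real.sign (u' - u) := by
    refine StronglyMeasurable.integral_prod_right'
      (f := fun p : ℝ × ℝ => g (p.2, x) * Real.sign (p.2 - p.1)) (Measurable.stronglyMeasurable ?_)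
    exact (hgm.comp measurable_snd).mul (by fun_prop)
  exact (integrable_fiber hfc hf x).mul_bdd (c := ∫ u' : ℝ, |g (u', x)|) hm.aestronglyMeasurable
    (Filter.Eventually.of_forall fun u => abs_integral_fiber_mul_sign_le hgc hg x u)

lemma rayForm_add {f f' g : ℝ × X → ℝ} (hfc : Continuous f) (hf : HasCompactSupport f)
    (hfc' : Continuous f') (hf' : HasCompactSupport f')
    (hgc : Continuous g) (hg : HasCompactSupport g) (x : X) :
    rayForm (f + f') g x = rayForm f g x + rayForm f' g x := by
  simp only [rayForm, Pi.add_apply, add_mul]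
  exact integral_add (integrable_ray hfc hf hgc hg x) (integrable_ray hfc' hf' hgc hg x)

lemma rayForm_swap {f g : ℝ × X → ℝ} (hfc : Continuous f) (hf : HasCompactSupport f)
    (hgc : Continuous g) (hg : HasCompactSupport g) (x : X) :
    rayForm g f x = -rayForm f g x := by
  have hfm : Measurable fun u : ℝ => f (u, x) := (by fun_prop : Continuous _).measurable
  have hgm : Measurable fun u : ℝ => g (u, x) := (by fun_prop : Continuous _).measurable
  have hint : Integrable (Function.uncurry fun u u' : ℝ =>
      f (u, x) * (g (u', x) * Real.sign (u' - u))) (volume.prod volume) := by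
    have h1 := ((integrable_fiber hfc hf x).mul_prod (integrable_fiber hgc hg x)).mul_bdd (c := 1)
      (g := fun p : ℝ × ℝ => Real.sign (p.2 - p.1))
      (Measurable.aestronglyMeasurable (by fun_prop))
      (Filter.Eventually.of_forall fun p => abs_sign_le_one _)
    refine h1.congr (Filter.Eventually.of_forall fun p => ?_)
    simp only [Function.uncurry]
    ring
  simp only [rayForm, ← integral_const_mul]
  rw [integral_integral_swap hint, ← integral_neg]
  congr 1
  ext u
  rw [← integral_neg]
  congr 1
  ext u'
  rw [← neg_sub u u', Real.sign_neg]
  ring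

lemma commForm_swap [MeasurableSpace X] (μ : Measure X) {f g : ℝ × X → ℝ}
    (hf : IsHalfTest f) (hg : IsHalfTest g) :
    commForm μ g f = -commForm μ f g := by
  simp only [commForm_eq, rayForm_swap hf.continuous hf.compact hg.continuous hg.compact,
    integral_neg]
  ring

/-- The second field of a commutator may be reflected to `u < 0` without effect: there the sign is
constant and the zero mode is absent. -/
lemma integral_reflect_mul_sign {g : ℝ × X → ℝ} (hg : IsHalfTest g) (x : X) {u : ℝ} (hu : 0 < u) :
    ∫ u' : ℝ, reflect g (u', x) * Real.sign (u' - u) = 0 := by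
  have h1 : ∀ u' : ℝ, reflect g (u', x) * Real.sign (u' - u) = -g (-u', x) := by
    intro u'
    simp only [reflect]
    rcases lt_or_ge u' 0 with h | h
    · rw [Real.sign_of_neg (by linarith)]; ring
    · rw [hg.half _ _ (by linarith)]; ring
  simp only [h1, integral_neg]
  rw [integral_neg_eq_self (fun u' => g (u', x)), hg.zeroMode, neg_zero]

lemma IsHalfTest.add {f g : ℝ × X → ℝ} (hf : IsHalfTest f) (hg : IsHalfTest g) :
    IsHalfTest (f + g) where
  continuous := hf.continuous.add hg.continuous
  compact := hf.compact.add hg.compact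
  half u x hu := by simp [hf.half u x hu, hg.half u x hu]
  zeroMode x := by
    simp only [Pi.add_apply]
    rw [integral_add (integrable_fiber hf.continuous hf.compact x)
      (integrable_fiber hg.continuous hg.compact x), hf.zeroMode, hg.zeroMode, add_zero]

lemma IsHalfTest.smul {f : ℝ × X → ℝ} (hf : IsHalfTest f) (t : ℝ) : IsHalfTest (t • f) where
  continuous := hf.continuous.const_smul t
  compact := hf.compact.smul_left (f := fun _ => t)
  half u x hu := by simp [hf.half u x hu]
  zeroMode x := by simp [integral_const_mul, hf.zeroMode]

lemma isHalfTest_zero : IsHalfTest (0 : ℝ × X → ℝ) where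
  continuous := continuous_const
  compact := HasCompactSupport.zero
  half _ _ _ := rfl
  zeroMode _ := by simp

variable [MeasurableSpace X] [BorelSpace X] [SecondCountableTopology X]

lemma integrable_rayForm (μ : Measure X) [IsFiniteMeasureOnCompacts μ] {f g : ℝ × X → ℝ}
    (hfc : Continuous f) (hf : HasCompactSupport f)
    (hgc : Continuous g) (hg : HasCompactSupport g) : Integrable (rayForm f g) μ := by
  obtain ⟨M, R, S, hS, hM0, hR0, hM, hs⟩ := exists_support_bound hfc hf
  obtain ⟨M', R', S', hS', hM0', hR0', hM', hs'⟩ := exists_support_bound hgc hg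
  have hfm := hfc.measurable
  have hgm := hgc.measurable
  have hm1 : StronglyMeasurable fun p : X × ℝ =>
      ∫ u' : ℝ, g (u', p.1) * Real.sign (u' - p.2) := by
    refine StronglyMeasurable.integral_prod_right'
      (f := fun r : (X × ℝ) × ℝ => g (r.2, r.1.1) * Real.sign (r.2 - r.1.2))
      (Measurable.stronglyMeasurable ?_)
    exact (hgm.comp (by fun_prop)).mul (by fun_prop)
  have hm : StronglyMeasurable (rayForm f g) := by
    refine StronglyMeasurable.integral_prod_right'
      (f := fun p : X × ℝ => f (p.2, p.1) * ∫ u' : ℝ, g (u', p.1) * Real.sign (u' - p.2))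
      (StronglyMeasurable.mul (Measurable.stronglyMeasurable (hfm.comp (by fun_prop))) hm1)
  have hint : ∀ {h : ℝ × X → ℝ} {M R : ℝ} {S : Set X}, Continuous h → HasCompactSupport h →
      0 ≤ M → 0 ≤ R → (∀ p, |h p| ≤ M) →
      (∀ u x, h (u, x) ≠ 0 → u ∈ Set.Icc (-R) R ∧ x ∈ S) →
      ∀ x, ∫ u : ℝ, |h (u, x)| ≤ M * (2 * R) := by
    intro h M R S hc hh hM0 hR0 hM hs x
    have h1 : ∫ u : ℝ, |h (u, x)| = ∫ u in Set.Icc (-R) R, |h (u, x)| := by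
      refine (setIntegral_eq_integral_of_forall_compl_eq_zero fun u hu => ?_).symm
      by_contra h0
      exact hu (hs u x fun h2 => h0 (by rw [h2, abs_zero])).1
    rw [h1]
    calc ∫ u in Set.Icc (-R) R, |h (u, x)| ≤ ∫ u in Set.Icc (-R) R, M :=
          setIntegral_mono (integrable_fiber hc hh x).abs.integrableOn
            (by simp) fun u => hM _
      _ = M * (2 * R) := by
          rw [setIntegral_const, Real.volume_real_Icc_of_le (by linarith), smul_eq_mul]; ring
  have hbound : ∀ x, ‖rayForm f g x‖ ≤ (M * (2 * R)) * (M' * (2 * R')) := by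
    intro x
    calc ‖rayForm f g x‖ ≤ ∫ u : ℝ, |f (u, x)| * ∫ u' : ℝ, |g (u', x)| := by
          refine (abs_integral_le_integral_abs).trans
            (integral_mono (integrable_ray hfc hf hgc hg x).abs
              ((integrable_fiber hfc hf x).abs.mul_const _) fun u => ?_)
          simp only [abs_mul]
          exact mul_le_mul_of_nonneg_left (abs_integral_fiber_mul_sign_le hgc hg x u) (abs_nonneg _)
      _ = (∫ u : ℝ, |f (u, x)|) * ∫ u' : ℝ, |g (u', x)| := integral_mul_const _ _
      _ ≤ _ := mul_le_mul (hint hfc hf hM0 hR0 hM hs x) (hint hgc hg hM0' hR0' hM' hs' x)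
          (integral_nonneg fun _ => abs_nonneg _) (by positivity)
  have hsupp : Function.support (rayForm f g) ⊆ S := by
    intro x hx
    by_contra hxS
    refine hx ?_
    have : ∀ u, f (u, x) = 0 := fun u => by
      by_contra h0
      exact hxS (hs u x h0).2
    simp [rayForm, this]
  rw [← integrableOn_iff_integrable_of_support_subset hsupp]
  exact Measure.integrableOn_of_bounded hS.measure_lt_top.ne hm.aestronglyMeasurable
    (Filter.Eventually.of_forall hbound)

variable (μ : Measure X) [IsFiniteMeasureOnCompacts μ]

lemma commForm_add {f f' g : ℝ × X → ℝ} (hf : IsHalfTest f) (hf' : IsHalfTest f')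
    (hg : IsHalfTest g) : commForm μ (f + f') g = commForm μ f g + commForm μ f' g := by
  simp only [commForm_eq]
  rw [← mul_add, ← integral_add
    (integrable_rayForm μ hf.continuous hf.compact hg.continuous hg.compact)
    (integrable_rayForm μ hf'.continuous hf'.compact hg.continuous hg.compact)]
  simp only [rayForm_add hf.continuous hf.compact hf'.continuous hf'.compact hg.continuous
    hg.compact]

end Kinematics

section Coordinates

variable {X : Type*} [TopologicalSpace X] [MeasurableSpace X] {ι : Type*}

lemma commForm_evenPart (μ : Measure X) {f g : ℝ × X → ℝ} (hf : IsHalfTest f) (hg : IsHalfTest g) :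
    commForm μ f (evenPart g) = commForm μ f g / 2 := by
  have h1 : ∀ x u, f (u, x) * ∫ u' : ℝ, evenPart g (u', x) * Real.sign (u' - u)
      = (1 / 2) * (f (u, x) * ∫ u' : ℝ, g (u', x) * Real.sign (u' - u)) := by
    intro x u
    rcases le_or_gt u 0 with hu | hu
    · simp [hf.half u x hu]
    · have h2 : ∀ u' : ℝ, evenPart g (u', x) * Real.sign (u' - u)
          = (1 / 2) * (g (u', x) * Real.sign (u' - u) + reflect g (u', x) * Real.sign (u' - u)) := by
        intro u'; simp only [evenPart]; ring
      have h3 : Integrable fun u' : ℝ => reflect g (u', x) * Real.sign (u' - u) :=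
        (integrable_fiber hg.continuous hg.compact x).comp_neg.mul_bdd (c := 1)
          (Measurable.aestronglyMeasurable (by fun_prop))
          (Filter.Eventually.of_forall fun u' => abs_sign_le_one _)
      simp only [h2, integral_const_mul]
      rw [integral_add (integrable_fiber_mul_sign hg.continuous hg.compact x u) h3,
        integral_reflect_mul_sign hg x hu]
      ring
  simp only [commForm_eq, rayForm, h1, integral_const_mul]
  ring

lemma commForm_oddPart (μ : Measure X) {f g : ℝ × X → ℝ} (hf : IsHalfTest f) (hg : IsHalfTest g) :
    commForm μ f (oddPart g) = commForm μ f g / 2 := by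
  have h1 : ∀ x u, f (u, x) * ∫ u' : ℝ, oddPart g (u', x) * Real.sign (u' - u)
      = (1 / 2) * (f (u, x) * ∫ u' : ℝ, g (u', x) * Real.sign (u' - u)) := by
    intro x u
    rcases le_or_gt u 0 with hu | hu
    · simp [hf.half u x hu]
    · have h2 : ∀ u' : ℝ, oddPart g (u', x) * Real.sign (u' - u)
          = (1 / 2) * (g (u', x) * Real.sign (u' - u) - reflect g (u', x) * Real.sign (u' - u)) := by
        intro u'; simp only [oddPart]; ring
      have h3 : Integrable fun u' : ℝ => reflect g (u', x) * Real.sign (u' - u) :=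
        (integrable_fiber hg.continuous hg.compact x).comp_neg.mul_bdd (c := 1)
          (Measurable.aestronglyMeasurable (by fun_prop))
          (Filter.Eventually.of_forall fun u' => abs_sign_le_one _)
      simp only [h2, integral_const_mul]
      rw [integral_sub (integrable_fiber_mul_sign hg.continuous hg.compact x u) h3,
        integral_reflect_mul_sign hg x hu]
      ring
  simp only [commForm_eq, rayForm, h1, integral_const_mul]
  ring

/-- `f` is a half-horizon test function with coordinates `z = x + i y`, as `∑ₖ (xₖ aₖ + yₖ bₖ)`; the
coordinates are read off from its commutators with the modes. -/
def HasCoord (μ : Measure X) (a b : ι → ℝ × X → ℝ) (f : ℝ × X → ℝ) (z : ι →₀ ℂ) : Prop :=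
  IsHalfTest f ∧ ∀ k, commForm μ f (b k) = (z k).re ∧ commForm μ f (a k) = -(z k).im

variable {μ : Measure X} {a b : ι → ℝ × X → ℝ}

lemma HasCoord.smul {f : ℝ × X → ℝ} {z : ι →₀ ℂ} (h : HasCoord μ a b f z) (t : ℝ) :
    HasCoord μ a b (t • f) ((t : ℂ) • z) :=
  ⟨h.1.smul t, fun k => by simp [commForm_smul, h.2 k]⟩

lemma hasCoord_zero : HasCoord μ a b 0 0 :=
  ⟨isHalfTest_zero, fun k => by simp [commForm]⟩

lemma hasCoord_a (hab : IsModeFamily μ a b) (j : ι) :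
    HasCoord μ a b (a j) (Finsupp.single j 1) := by
  classical
  refine ⟨hab.test_a j, fun k => ⟨?_, by simp [hab.comm_aa, Finsupp.single_apply, apply_ite]⟩⟩
  rcases eq_or_ne j k with rfl | h
  · simp [hab.comm_ab]
  · simp [hab.comm_ab_ne j k h, h]

lemma hasCoord_b (hab : IsModeFamily μ a b) (j : ι) :
    HasCoord μ a b (b j) (Finsupp.single j Complex.I) := by
  classical
  refine ⟨hab.test_b j, fun k => ⟨by simp [hab.comm_bb, Finsupp.single_apply, apply_ite], ?_⟩⟩
  rw [commForm_swap μ (hab.test_a k) (hab.test_b j)]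
  rcases eq_or_ne j k with rfl | h
  · simp [hab.comm_ab]
  · simp [hab.comm_ab_ne k j h.symm, h]

variable [BorelSpace X] [SecondCountableTopology X] [IsFiniteMeasureOnCompacts μ]

lemma HasCoord.add (hab : IsModeFamily μ a b) {f f' : ℝ × X → ℝ} {z z' : ι →₀ ℂ}
    (h : HasCoord μ a b f z) (h' : HasCoord μ a b f' z') : HasCoord μ a b (f + f') (z + z') :=
  ⟨h.1.add h'.1, fun k => by
    rw [commForm_add μ h.1 h'.1 (hab.test_b k), commForm_add μ h.1 h'.1 (hab.test_a k),
      (h.2 k).1, (h.2 k).2, (h'.2 k).1, (h'.2 k).2]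
    simp only [Finsupp.add_apply, Complex.add_re, Complex.add_im]
    exact ⟨trivial, by ring⟩⟩

lemma exists_hasCoord_of_mem (hab : IsModeFamily μ a b) {f : ℝ × X → ℝ} (hf : f ∈ halfTests a b) :
    ∃ z, HasCoord μ a b f z := by
  induction hf using Submodule.span_induction with
  | mem f hf =>
    rcases hf with ⟨j, rfl⟩ | ⟨j, rfl⟩
    · exact ⟨_, hasCoord_a hab j⟩
    · exact ⟨_, hasCoord_b hab j⟩
  | zero => exact ⟨0, hasCoord_zero⟩
  | add f g _ _ hf hg =>
    obtain ⟨z, hz⟩ := hf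
    obtain ⟨w, hw⟩ := hg
    exact ⟨_, hz.add hab hw⟩
  | smul t f _ hf =>
    obtain ⟨z, hz⟩ := hf
    exact ⟨_, hz.smul t⟩

lemma exists_mem_hasCoord (hab : IsModeFamily μ a b) (z : ι →₀ ℂ) :
    ∃ f ∈ halfTests a b, HasCoord μ a b f z := by
  induction z using Finsupp.induction_linear with
  | zero => exact ⟨0, Submodule.zero_mem _, hasCoord_zero⟩
  | add z w hz hw =>
    obtain ⟨f, hf, hfz⟩ := hz
    obtain ⟨g, hg, hgw⟩ := hw
    exact ⟨f + g, Submodule.add_mem _ hf hg, hfz.add hab hgw⟩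
  | single k w =>
    refine ⟨w.re • a k + w.im • b k, Submodule.add_mem _
      (Submodule.smul_mem _ _ (Submodule.subset_span (Or.inl ⟨k, rfl⟩)))
      (Submodule.smul_mem _ _ (Submodule.subset_span (Or.inr ⟨k, rfl⟩))), ?_⟩
    have h := ((hasCoord_a hab k).smul w.re).add hab ((hasCoord_b hab k).smul w.im)
    rwa [Finsupp.smul_single, Finsupp.smul_single, ← Finsupp.single_add, smul_eq_mul, smul_eq_mul,
      mul_one, Complex.re_add_im] at h

end Coordinates

section Exponentials

variable {X : Type*} [MeasurableSpace X] {ι : Type*} {μ : Measure X} {a b : ι → ℝ × X → ℝ}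

lemma IsHalfExp.unique {f : ℝ × X → ℝ} {U U' : HalfSpace ι →L[ℂ] HalfSpace ι}
    (h : IsHalfExp μ a b f U) (h' : IsHalfExp μ a b f U') : U = U' :=
  ContinuousLinearMap.ext fun G => Lp.ext ((h.2 G).trans (h'.2 G).symm)

lemma IsHorizonExp.unique {f : ℝ × X → ℝ} {V V' : OddSpace ι →L[ℂ] OddSpace ι}
    (h : IsHorizonExp μ a b f V) (h' : IsHorizonExp μ a b f V') : V = V' :=
  ContinuousLinearMap.ext fun F => Lp.ext ((h.2 F).trans (h'.2 F).symm)

variable [TopologicalSpace X]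

lemma HasCoord.isHalfExp {f : ℝ × X → ℝ} {z : ι →₀ ℂ} (h : HasCoord μ a b f z) :
    IsHalfExp μ a b f (weylOp (1 / 2) z) := by
  refine ⟨weylOp_mem_unitary _ z, fun G => ?_⟩
  have h1 : (fun k => -commForm μ f (a k)) = fun k => (z k).im := by
    ext k; rw [(h.2 k).2, neg_neg]
  have h2 : (fun k => -commForm μ f (b k)) = weylShift (1 / 2) z := by
    ext k; rw [(h.2 k).1]; simp [weylShift]
  rw [h1, h2]
  exact weylOp_ae_eq_weylAct (by norm_num) z G

lemma HasCoord.isHorizonExp (hab : IsModeFamily μ a b) {f : ℝ × X → ℝ} {z : ι →₀ ℂ}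
    (h : HasCoord μ a b f z) : IsHorizonExp μ a b f (weylOp (1 / 4) (oddVec z 0)) := by
  refine ⟨weylOp_mem_unitary _ _, fun F => ?_⟩
  have h1 : Sum.elim (fun k => 2 * commForm μ f (evenPart (b k)))
      (fun k => -2 * commForm μ f (evenPart (a k))) = fun k => (oddVec z 0 k).im := by
    ext (k | k)
    · simp [commForm_evenPart μ h.1 (hab.test_b k), (h.2 k).1, oddVec]; ring
    · simp [commForm_evenPart μ h.1 (hab.test_a k), (h.2 k).2, oddVec]; ring
  have h2 : Sum.elim (fun k => -commForm μ f (oddPart (a k)))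
      (fun k => -commForm μ f (oddPart (b k))) = weylShift (1 / 4) (oddVec z 0) := by
    ext (k | k)
    · simp [commForm_oddPart μ h.1 (hab.test_a k), (h.2 k).2, oddVec, weylShift]; ring
    · simp [commForm_oddPart μ h.1 (hab.test_b k), (h.2 k).1, oddVec, weylShift]; ring
  rw [h1, h2]
  exact weylOp_ae_eq_weylAct (by norm_num) _ F

end Exponentials

/-! ### Gaussian wave packets of finitely many modes -/

section Flat

variable {P : Type*} [Fintype P]

lemma refAmp_pos {v : ℝ≥0} (hv : v ≠ 0) (q : P → ℝ) : 0 < refAmp v q :=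
  Finset.prod_pos fun _ _ => Real.sqrt_pos.2 (gaussianPDFReal_pos _ _ _ hv)

lemma sq_refAmp (v : ℝ≥0) (q : P → ℝ) : refAmp v q ^ 2 = ∏ k, gaussianPDFReal 0 v (q k) := by
  rw [refAmp, ← Finset.prod_pow]
  exact Finset.prod_congr rfl fun k _ => Real.sq_sqrt (gaussianPDFReal_nonneg _ _ _)

lemma continuous_refAmp (v : ℝ≥0) : Continuous fun q : P → ℝ => refAmp v q := by
  unfold refAmp
  simp only [gaussianPDFReal_def]
  fun_prop

lemma measurable_ofReal_sq_refAmp (v : ℝ≥0) :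
    Measurable fun q : P → ℝ => ENNReal.ofReal (refAmp v q ^ 2) :=
  ((continuous_refAmp v).pow 2).measurable.ennreal_ofReal

/-- For finitely many modes the Gaussian measure is `Ω² 𝒟q`. -/
lemma gauss_eq_withDensity {v : ℝ≥0} (hv : v ≠ 0) :
    gauss P v = volume.withDensity fun q => ENNReal.ofReal (refAmp v q ^ 2) := by
  have hint : Integrable (fun q : P → ℝ => refAmp v q ^ 2) := by
    simp only [sq_refAmp]
    exact Integrable.fintype_prod (f := fun _ x => gaussianPDFReal 0 v x)
      fun _ => integrable_gaussianPDFReal 0 v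
  have := isFiniteMeasure_withDensity_ofReal hint.2
  refine ext_of_integral_exp_imagVec fun m => ?_
  have hexp : ∀ q : P → ℝ, Complex.exp (dot (imagVec m) (fun k => (q k : ℂ)))
      = ∏ k, Complex.exp (m k * Complex.I * q k) := by
    intro q
    rw [dot_eq_sum_of_subset _ _ (Finset.subset_univ _), Complex.exp_sum]
    rfl
  rw [integral_withDensity_eq_integral_toReal_smul₀
    (measurable_ofReal_sq_refAmp v).aemeasurable (by simp)]
  simp only [ENNReal.toReal_ofReal (sq_nonneg _)]
  simp only [hexp, sq_refAmp, Complex.real_smul]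
  push_cast
  simp only [← Finset.prod_mul_distrib]
  rw [gauss, Measure.infinitePi_eq_pi,
    integral_fintype_prod_eq_prod (fun (k : P) (x : ℝ) => Complex.exp (m k * Complex.I * x)),
    integral_fintype_prod_volume_eq_prod (fun (k : P) (x : ℝ) =>
      (gaussianPDFReal 0 v x : ℂ) * Complex.exp (m k * Complex.I * x))]
  refine Finset.prod_congr rfl fun k _ => ?_
  rw [integral_gaussianReal_eq_integral_smul hv]
  simp only [Complex.real_smul]

lemma integral_gauss_eq {v : ℝ≥0} (hv : v ≠ 0) (F : (P → ℝ) → ℂ) :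
    ∫ q, F q ∂(gauss P v) = ∫ q, (refAmp v q : ℂ) ^ 2 * F q := by
  rw [gauss_eq_withDensity hv, integral_withDensity_eq_integral_toReal_smul₀
    (measurable_ofReal_sq_refAmp v).aemeasurable (by simp)]
  simp only [ENNReal.toReal_ofReal (sq_nonneg _), Complex.real_smul]
  push_cast
  rfl

lemma integrable_gauss_iff {v : ℝ≥0} (hv : v ≠ 0) (F : (P → ℝ) → ℂ) :
    Integrable F (gauss P v) ↔ Integrable fun q => (refAmp v q : ℂ) ^ 2 * F q := by
  rw [gauss_eq_withDensity hv, integrable_withDensity_iff_integrable_smul'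
    (measurable_ofReal_sq_refAmp v) (by simp)]
  simp only [ENNReal.toReal_ofReal (sq_nonneg _), Complex.real_smul]
  push_cast
  rfl

/-- The exponential vector of `c` as a flat wavefunction. -/
def wave (v : ℝ≥0) (c : P →₀ ℂ) (q : P → ℝ) : ℂ := refAmp v q * expFun v c q

lemma continuous_wave (v : ℝ≥0) (c : P →₀ ℂ) : Continuous (wave v c) := by
  have h1 : Continuous fun q : P → ℝ => (refAmp v q : ℂ) :=
    Complex.continuous_ofReal.comp (continuous_refAmp v)
  have h2 : Continuous (expFun v c) := by
    unfold expFun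
    simp only [dot_eq_sum]
    fun_prop
  exact h1.mul h2

/-- One mode of a wave packet. -/
def wave₁ (v : ℝ≥0) (c : ℂ) (x : ℝ) : ℂ :=
  √(gaussianPDFReal 0 v x) * Complex.exp (c * x - v / 2 * c ^ 2)

lemma wave_eq_prod (v : ℝ≥0) (c : P →₀ ℂ) (q : P → ℝ) : wave v c q = ∏ k, wave₁ v (c k) (q k) := by
  have h : expFun v c q = ∏ k, Complex.exp (c k * q k - v / 2 * c k ^ 2) := by
    rw [expFun_eq_prod v c q (Finset.subset_univ _)]
    exact Finset.prod_coe_sort Finset.univ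
      fun k => Complex.exp (c k * q k - v / 2 * c k ^ 2)
  rw [wave, h, refAmp]
  push_cast
  rw [← Finset.prod_mul_distrib]
  rfl

lemma wave₁_eq {v : ℝ≥0} (c : ℂ) (x : ℝ) :
    wave₁ v c x = √(√(2 * Real.pi * v))⁻¹ *
      Complex.exp (-(1 / (4 * v)) * x ^ 2 + c * x - v / 2 * c ^ 2) := by
  have h : √(gaussianPDFReal 0 v x)
      = √(√(2 * Real.pi * v))⁻¹ * Real.exp (-(1 / (4 * v)) * x ^ 2) := by
    rw [gaussianPDFReal_def, Real.sqrt_mul (by positivity)]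
    congr 1
    rw [Real.sqrt_eq_iff_eq_sq (by positivity) (by positivity), ← Real.exp_nat_mul]
    congr 1
    push_cast
    field_simp
    ring
  rw [wave₁, h]
  push_cast
  rw [mul_assoc, ← Complex.exp_add]
  congr 2
  ring

lemma integrable_wave₁ {v : ℝ≥0} (hv : v ≠ 0) (c : ℂ) : Integrable (wave₁ v c) := by
  have hv' : (0 : ℝ) < v := by positivity
  have h : wave₁ v c = fun x : ℝ => (√(√(2 * Real.pi * v))⁻¹ : ℂ) *
      Complex.exp (-((1 / (4 * v) : ℝ) : ℂ) * x ^ 2 + c * x + -(v / 2 * c ^ 2)) := by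
    ext x
    rw [wave₁_eq, sub_eq_add_neg]
    push_cast
    rfl
  rw [h]
  refine (integrable_cexp_quadratic ?_ c _).const_mul _
  rw [Complex.ofReal_re]
  positivity

lemma integrable_wave {v : ℝ≥0} (hv : v ≠ 0) (c : P →₀ ℂ) : Integrable (wave v c) := by
  rw [show wave v c = fun q => ∏ k, wave₁ v (c k) (q k) from funext (wave_eq_prod v c)]
  exact Integrable.fintype_prod (f := fun (k : P) (x : ℝ) => wave₁ v (c k) x)
    fun k => integrable_wave₁ hv (c k)

lemma wave₁_wigner (α β : ℂ) (l B : ℝ) :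
    ((√(2 * Real.pi) : ℝ) : ℂ)⁻¹ *
        (∫ A : ℝ, Complex.exp (Complex.I * (A * l)) * wave₁ (1 / 4) (Complex.I * (α - β)) A) *
        wave₁ (1 / 4) (α + β) B
      = wave₁ (1 / 2) α (B - 1 / 2 * l) * wave₁ (1 / 2) β (B + 1 / 2 * l) := by
  have hint : ∀ A : ℝ, Complex.exp (Complex.I * (A * l)) *
        wave₁ (1 / 4) (Complex.I * (α - β)) A
      = √(√(2 * Real.pi * (1 / 4 : ℝ≥0)))⁻¹ * Complex.exp ((-1) * (A : ℂ) ^ 2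
          + (Complex.I * l + Complex.I * (α - β)) * A + (1 / 8) * (α - β) ^ 2) := by
    intro A
    rw [wave₁_eq, mul_left_comm, ← Complex.exp_add]
    congr 2
    push_cast
    rw [mul_pow, Complex.I_sq]
    ring
  have hc : (√(2 * Real.pi))⁻¹ * (√(√(2 * Real.pi * (1 / 4 : ℝ≥0)))⁻¹) ^ 2 * √Real.pi
      = (√(√(2 * Real.pi * (1 / 2 : ℝ≥0)))⁻¹) ^ 2 := by
    rw [Real.sq_sqrt (by positivity), Real.sq_sqrt (by positivity)]
    have h1 : √(2 * Real.pi * ((1 / 4 : ℝ≥0) : ℝ)) = √(2 * Real.pi) / 2 := by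
      rw [Real.sqrt_eq_iff_eq_sq (by positivity) (by positivity), div_pow,
        Real.sq_sqrt (by positivity)]
      push_cast; ring
    have h2 : √(2 * Real.pi * ((1 / 2 : ℝ≥0) : ℝ)) = √Real.pi := by
      congr 1; push_cast; ring
    rw [h1, h2]
    have h3 := Real.sq_sqrt (show (0 : ℝ) ≤ 2 * Real.pi by positivity)
    have h4 := Real.sq_sqrt Real.pi_nonneg
    have h5 : 0 < √(2 * Real.pi) := by positivity
    have h6 : 0 < √Real.pi := by positivity
    field_simp
    rw [h3, h4]
  simp only [hint]
  rw [integral_const_mul, integral_cexp_quadratic (by simp)]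
  have hpi : ((Real.pi : ℂ) / - -1) ^ (1 / 2 : ℂ) = (√Real.pi : ℂ) := by
    rw [neg_neg, div_one, Real.sqrt_eq_rpow, Complex.ofReal_cpow Real.pi_nonneg]
    push_cast; rfl
  rw [hpi, wave₁_eq, wave₁_eq, wave₁_eq]
  have hexp : Complex.exp (1 / 8 * (α - β) ^ 2
        - (Complex.I * l + Complex.I * (α - β)) ^ 2 / (4 * (-1))) *
      Complex.exp (-(1 / (4 * ((1 / 4 : ℝ≥0) : ℂ))) * B ^ 2 + (α + β) * B
        - ((1 / 4 : ℝ≥0) : ℂ) / 2 * (α + β) ^ 2)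
      = Complex.exp (-(1 / (4 * ((1 / 2 : ℝ≥0) : ℂ))) * ((B - 1 / 2 * l : ℝ) : ℂ) ^ 2
          + α * ((B - 1 / 2 * l : ℝ) : ℂ) - ((1 / 2 : ℝ≥0) : ℂ) / 2 * α ^ 2) *
        Complex.exp (-(1 / (4 * ((1 / 2 : ℝ≥0) : ℂ))) * ((B + 1 / 2 * l : ℝ) : ℂ) ^ 2
          + β * ((B + 1 / 2 * l : ℝ) : ℂ) - ((1 / 2 : ℝ≥0) : ℂ) / 2 * β ^ 2) := by
    rw [← Complex.exp_add, ← Complex.exp_add]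
    congr 1
    push_cast
    rw [← mul_add, mul_pow, Complex.I_sq]
    ring
  have hc' := congrArg (fun x : ℝ => (x : ℂ)) hc
  push_cast at hc'
  push_cast at hexp ⊢
  linear_combination (Complex.exp (1 / 8 * (α - β) ^ 2
        - (Complex.I * l + Complex.I * (α - β)) ^ 2 / (4 * (-1))) *
      Complex.exp (-(1 / (4 * (1 / 4))) * B ^ 2 + (α + β) * B
        - (1 / 4) / 2 * (α + β) ^ 2)) * hc' + (√(√(2 * Real.pi * (1 / 2)))⁻¹ : ℂ) ^ 2 * hexp

/-- The Gaussian integral behind the Wigner–Weyl transform: integrating a wave packet in `A` against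
`exp (i A·λ)` separates it into wave packets in `B₁ = B - λ/2` and `B₂ = B + λ/2`. -/
lemma wave_wigner (α β : P →₀ ℂ) (l B : P → ℝ) :
    ((1 / √(2 * Real.pi) ^ Fintype.card P : ℝ) : ℂ) *
        (∫ A : P → ℝ, Complex.exp (Complex.I * ((∑ k, A k * l k : ℝ) : ℂ)) *
          wave (1 / 4) (Complex.I • (α - β)) A) * wave (1 / 4) (α + β) B
      = wave (1 / 2) α (B - (1 / 2 : ℝ) • l) * wave (1 / 2) β (B + (1 / 2 : ℝ) • l) := by
  have h : ∀ A : P → ℝ, Complex.exp (Complex.I * ((∑ k, A k * l k : ℝ) : ℂ)) *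
        wave (1 / 4) (Complex.I • (α - β)) A
      = ∏ k, (Complex.exp (Complex.I * (A k * l k)) *
          wave₁ (1 / 4) (Complex.I * (α k - β k)) (A k)) := by
    intro A
    rw [wave_eq_prod, Finset.prod_mul_distrib, ← Complex.exp_sum, ← Finset.mul_sum]
    push_cast
    rfl
  simp only [h]
  rw [integral_fintype_prod_volume_eq_prod (fun (k : P) (x : ℝ) =>
    Complex.exp (Complex.I * (x * l k)) * wave₁ (1 / 4) (Complex.I * (α k - β k)) x),
    wave_eq_prod, wave_eq_prod, wave_eq_prod, ← Finset.prod_mul_distrib]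
  have hc : ((1 / √(2 * Real.pi) ^ Fintype.card P : ℝ) : ℂ)
      = ∏ _k : P, ((√(2 * Real.pi) : ℝ) : ℂ)⁻¹ := by
    rw [Finset.prod_const, Finset.card_univ]
    push_cast
    rw [one_div, inv_pow]
  rw [hc, ← Finset.prod_mul_distrib, ← Finset.prod_mul_distrib]
  exact Finset.prod_congr rfl fun k _ => wave₁_wigner (α k) (β k) (l k) (B k)

end Flat

/-! ### Cross-Wigner functions of finitely many modes -/

section MidPoint

variable {P : Type*}

/-- The change of variables from midpoint `B` and difference `l` to `B₁ = B - l/2`, `B₂ = B + l/2`. -/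
def midHomeo (P : Type*) : (P → ℝ) × (P → ℝ) ≃ₜ (P → ℝ) × (P → ℝ) where
  toFun p := (p.1 - (1 / 2 : ℝ) • p.2, p.1 + (1 / 2 : ℝ) • p.2)
  invFun p := ((1 / 2 : ℝ) • (p.1 + p.2), p.2 - p.1)
  left_inv p := by ext k <;> simp <;> ring
  right_inv p := by ext k <;> simp <;> ring
  continuous_toFun := by fun_prop
  continuous_invFun := by fun_prop

lemma measurePreserving_midHomeo [Fintype P] : MeasurePreserving (midHomeo P) := by
  have h1 : MeasurePreserving (fun p : (P → ℝ) × (P → ℝ) => (p.2, p.1)) :=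
    Measure.measurePreserving_swap
  have h2 : MeasurePreserving (fun p : (P → ℝ) × (P → ℝ) => (p.1, p.2 - (1 / 2 : ℝ) • p.1)) :=
    MeasurePreserving.skew_product (g := fun l B : P → ℝ => B - (1 / 2 : ℝ) • l)
      (MeasurePreserving.id volume) (by fun_prop)
      (Filter.Eventually.of_forall fun l => (measurePreserving_sub_right volume _).map_eq)
  have h3 : MeasurePreserving (fun p : (P → ℝ) × (P → ℝ) => (p.1, p.1 + p.2)) :=
    measurePreserving_prod_add volume volume
  convert h3.comp (h1.comp (h2.comp h1)) using 1
  ext p k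
  · simp [midHomeo]
  · simp [midHomeo]; ring

lemma integral_mul_mid [Fintype P] {r s : (P → ℝ) → ℂ} :
    ∫ p : (P → ℝ) × (P → ℝ), r (p.1 - (1 / 2 : ℝ) • p.2) * s (p.1 + (1 / 2 : ℝ) • p.2)
      = (∫ x, r x) * ∫ y, s y := by
  rw [← integral_prod_mul r s]
  exact (measurePreserving_midHomeo (P := P)).integral_comp
    (midHomeo P).measurableEmbedding (fun z => r z.1 * s z.2)

end MidPoint

section CrossWigner

variable {ι : Type*} (J : Finset ι) {g h : (J → ℝ) → ℂ}

/-- The integrand of the matrix element of a wave packet on phase space, over `((A, B), l)`. -/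
def wignerIntegrand (g h : (J → ℝ) → ℂ) (α β : J →₀ ℂ)
    (p : ((J → ℝ) × (J → ℝ)) × (J → ℝ)) : ℂ :=
  ((1 / √(2 * Real.pi) ^ J.card : ℝ) : ℂ) *
    (Complex.exp (Complex.I * ((∑ k, p.1.1 k * p.2 k : ℝ) : ℂ)) *
      (wave (1 / 4) (Complex.I • (α - β)) p.1.1 * (wave (1 / 4) (α + β) p.1.2 *
        (conj (g (p.1.2 - (1 / 2 : ℝ) • p.2)) * h (p.1.2 + (1 / 2 : ℝ) • p.2)))))

lemma integral_wignerIntegrand (α β : J →₀ ℂ) (A B : J → ℝ) :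
    ∫ l, wignerIntegrand J g h α β ((A, B), l)
      = wave (1 / 4) (Complex.I • (α - β)) A * wave (1 / 4) (α + β) B * crossWigner J g h A B := by
  simp only [wignerIntegrand, crossWigner]
  rw [integral_const_mul, mul_left_comm]
  congr 1
  rw [← integral_const_mul]
  refine integral_congr_ae (Filter.Eventually.of_forall fun l => ?_)
  ring

lemma integrable_wignerIntegrand (hg : Continuous g) (hgc : HasCompactSupport g)
    (hh : Continuous h) (hhc : HasCompactSupport h) (α β : J →₀ ℂ) :
    Integrable (wignerIntegrand J g h α β) := by
  have hw : HasCompactSupport fun p : (J → ℝ) × (J → ℝ) => conj (g p.1) * h p.2 := by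
    refine HasCompactSupport.intro (hgc.isCompact.prod hhc.isCompact) fun p hp => ?_
    rw [Set.mem_prod, not_and_or] at hp
    rcases hp with hp | hp
    · rw [image_eq_zero_of_notMem_tsupport hp, map_zero, zero_mul]
    · rw [image_eq_zero_of_notMem_tsupport hp, mul_zero]
  have hw' := hw.comp_homeomorph (midHomeo J)
  have hwave := continuous_wave (1 / 4) (α + β)
  have hBl : Integrable (fun p : (J → ℝ) × (J → ℝ) => wave (1 / 4) (α + β) p.1 *
      (conj (g (p.1 - (1 / 2 : ℝ) • p.2)) * h (p.1 + (1 / 2 : ℝ) • p.2))) := by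
    refine Continuous.integrable_of_hasCompactSupport ?_ (hw'.mul_left)
    have := Complex.continuous_conj
    fun_prop
  have hABl := (integrable_wave (v := 1 / 4) (by norm_num) (Complex.I • (α - β))).mul_prod hBl
  have hassoc := (volume_preserving_prodAssoc (α₁ := J → ℝ) (β₁ := J → ℝ)
    (γ₁ := J → ℝ)).integrable_comp_of_integrable hABl
  refine (hassoc.bdd_mul (c := 1)
    (f := fun p : ((J → ℝ) × (J → ℝ)) × (J → ℝ) =>
      Complex.exp (Complex.I * ((∑ k, p.1.1 k * p.2 k : ℝ) : ℂ)))
    (Continuous.aestronglyMeasurable (by fun_prop)) (Filter.Eventually.of_forall fun p => ?_)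
    ).const_mul _
  rw [mul_comm, Complex.norm_exp_ofReal_mul_I]

lemma integral_integral_wignerIntegrand (α β : J →₀ ℂ) (B l : J → ℝ) :
    ∫ A, wignerIntegrand J g h α β ((A, B), l)
      = (conj (g (B - (1 / 2 : ℝ) • l)) * wave (1 / 2) α (B - (1 / 2 : ℝ) • l)) *
        (h (B + (1 / 2 : ℝ) • l) * wave (1 / 2) β (B + (1 / 2 : ℝ) • l)) := by
  have hG := wave_wigner α β l B
  rw [Fintype.card_coe] at hG
  simp only [wignerIntegrand]
  rw [integral_const_mul]
  simp only [← mul_assoc (Complex.exp _)]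
  rw [integral_mul_const]
  linear_combination (conj (g (B - (1 / 2 : ℝ) • l)) * h (B + (1 / 2 : ℝ) • l)) * hG

lemma integral_wave_mul_crossWigner (hg : Continuous g) (hgc : HasCompactSupport g)
    (hh : Continuous h) (hhc : HasCompactSupport h) (α β : J →₀ ℂ) :
    ∫ p : (J → ℝ) × (J → ℝ), wave (1 / 4) (Complex.I • (α - β)) p.1 * wave (1 / 4) (α + β) p.2 *
        crossWigner J g h p.1 p.2
      = (∫ x, conj (g x) * wave (1 / 2) α x) * ∫ y, h y * wave (1 / 2) β y := by
  have hint := integrable_wignerIntegrand J hg hgc hh hhc α β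
  have hmp := (volume_preserving_prodAssoc (α₁ := J → ℝ) (β₁ := J → ℝ) (γ₁ := J → ℝ))
  have hint' : Integrable (fun z : (J → ℝ) × ((J → ℝ) × (J → ℝ)) =>
      wignerIntegrand J g h α β ((z.1, z.2.1), z.2.2)) :=
    (hmp.integrable_comp_emb MeasurableEquiv.prodAssoc.measurableEmbedding).1 hint
  simp only [← integral_wignerIntegrand]
  rw [← integral_mul_mid (r := fun x => conj (g x) * wave (1 / 2) α x)
    (s := fun y => h y * wave (1 / 2) β y)]
  simp only [← integral_integral_wignerIntegrand]
  rw [← integral_prod_symm _ hint']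
  exact (integral_prod _ hint).symm.trans (hmp.integral_comp'
    (fun z => wignerIntegrand J g h α β ((z.1, z.2.1), z.2.2)))

/-- The density of a cross-Wigner function on the phase space of the modes in `J`. -/
def wignerDensity (g h : (J → ℝ) → ℂ) (q : J ⊕ J → ℝ) : ℂ :=
  crossWigner J g h (fun k => q (Sum.inl k)) (fun k => q (Sum.inr k)) / (refAmp (1 / 4) q : ℂ)

lemma refAmp_mul_expFun_oddVec {P : Type*} [Fintype P] (α β : P →₀ ℂ) (q : P ⊕ P → ℝ) :
    (refAmp (1 / 4) q : ℂ) * expFun (1 / 4) (oddVec α β) q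
      = wave (1 / 4) (Complex.I • (α - β)) (fun k => q (Sum.inl k)) *
        wave (1 / 4) (α + β) (fun k => q (Sum.inr k)) := by
  rw [← wave, wave_eq_prod, Fintype.prod_sum_type, wave_eq_prod, wave_eq_prod]
  simp only [oddVec, sumVec_inl, sumVec_inr]

lemma sq_refAmp_mul_wignerDensity (α β : J →₀ ℂ) (q : J ⊕ J → ℝ) :
    (refAmp (1 / 4) q : ℂ) ^ 2 * (expFun (1 / 4) (oddVec α β) q * wignerDensity J g h q)
      = wave (1 / 4) (Complex.I • (α - β)) (fun k => q (Sum.inl k)) *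
        wave (1 / 4) (α + β) (fun k => q (Sum.inr k)) *
        crossWigner J g h (fun k => q (Sum.inl k)) (fun k => q (Sum.inr k)) := by
  have h0 : (refAmp (1 / 4) q : ℂ) ≠ 0 := by exact_mod_cast (refAmp_pos (by norm_num) q).ne'
  rw [← refAmp_mul_expFun_oddVec, wignerDensity]
  field_simp

lemma integrable_wignerDensity (hg : Continuous g) (hgc : HasCompactSupport g)
    (hh : Continuous h) (hhc : HasCompactSupport h) :
    Integrable (wignerDensity J g h) (gauss (J ⊕ J) (1 / 4)) := by
  rw [integrable_gauss_iff (by norm_num)]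
  have hint := (integrable_wignerIntegrand J hg hgc hh hhc 0 0).integral_prod_left
  simp only [integral_wignerIntegrand] at hint
  refine ((volume_measurePreserving_sumPiEquivProdPi
    (fun _ : J ⊕ J => ℝ)).integrable_comp_of_integrable hint).congr
    (Filter.Eventually.of_forall fun q => ?_)
  have hq := sq_refAmp_mul_wignerDensity J (g := g) (h := h) 0 0 q
  have h0 : oddVec (0 : J →₀ ℂ) 0 = 0 := by ext (k | k) <;> simp [oddVec]
  rw [h0, expFun_zero, one_mul] at hq
  exact hq.symm

lemma integral_expFun_mul_wignerDensity (hg : Continuous g) (hgc : HasCompactSupport g)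
    (hh : Continuous h) (hhc : HasCompactSupport h) (α β : J →₀ ℂ) :
    ∫ q, expFun (1 / 4) (oddVec α β) q * wignerDensity J g h q ∂(gauss (J ⊕ J) (1 / 4))
      = (∫ x, conj (g x) * wave (1 / 2) α x) * ∫ y, h y * wave (1 / 2) β y := by
  rw [integral_gauss_eq (by norm_num)]
  simp only [sq_refAmp_mul_wignerDensity]
  rw [← integral_wave_mul_crossWigner J hg hgc hh hhc α β]
  exact (volume_measurePreserving_sumPiEquivProdPi (fun _ : J ⊕ J => ℝ)).integral_comp'
    (fun p : (J → ℝ) × (J → ℝ) => wave (1 / 4) (Complex.I • (α - β)) p.1 *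
      wave (1 / 4) (α + β) p.2 * crossWigner J g h p.1 p.2)

end CrossWigner

/-! ### The Wigner–Weyl transform as a Hilbert space isomorphism -/

section Pullback

variable {P κ : Type*}

lemma measurePreserving_reindex (v : ℝ≥0) {e : P → κ} (he : Function.Injective e) :
    MeasurePreserving (fun (q : κ → ℝ) k => q (e k)) (gauss κ v) (gauss P v) :=
  ⟨by fun_prop, Measure.map_infinitePi_infinitePi_of_inj he⟩

/-- A functional of some of the components, as a functional of all of them. -/
def pullback (v : ℝ≥0) {e : P → κ} (he : Function.Injective e) :
    Lp ℂ 2 (gauss P v) →ₗᵢ[ℂ] Lp ℂ 2 (gauss κ v) :=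
  Lp.compMeasurePreservingₗᵢ ℂ _ (measurePreserving_reindex v he)

lemma coeFn_pullback (v : ℝ≥0) {e : P → κ} (he : Function.Injective e) (F : Lp ℂ 2 (gauss P v)) :
    pullback v he F =ᵐ[gauss κ v] fun q => F fun k => q (e k) :=
  Lp.coeFn_compMeasurePreserving F (measurePreserving_reindex v he)

lemma expFun_mapDomain (v : ℝ≥0) {e : P → κ} (he : Function.Injective e) (c : P →₀ ℂ)
    (q : κ → ℝ) : expFun v (c.mapDomain e) q = expFun v c fun k => q (e k) := by
  have h : ∀ p : κ → ℂ, dot (c.mapDomain e) p = dot c fun k => p (e k) := fun p =>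
    Finsupp.linearCombination_mapDomain _ _ _
  rw [expFun, h, h]
  simp only [Finsupp.mapDomain_apply he]
  rfl

lemma pullback_expVec (v : ℝ≥0) {e : P → κ} (he : Function.Injective e) (c : P →₀ ℂ) :
    pullback v he (expVec v c) = expVec v (c.mapDomain e) := by
  refine Lp.ext ?_
  filter_upwards [coeFn_pullback v he (expVec v c), coeFn_expVec v (c.mapDomain e),
    (measurePreserving_reindex v he).quasiMeasurePreserving.ae (coeFn_expVec v c)] with q h1 h2 h3
  rw [h1, h2, h3, expFun_mapDomain v he]

lemma oddVec_mapDomain {e : P → κ} (α β : P →₀ ℂ) :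
    oddVec (α.mapDomain e) (β.mapDomain e) = (oddVec α β).mapDomain (Sum.map e e) := by
  simp only [oddVec, sumVec, Finsupp.mapDomain_add, ← Finsupp.mapDomain_comp, sub_eq_add_neg,
    Finsupp.mapDomain_smul, smul_add]
  have hneg : Finsupp.mapDomain e (-β) = -Finsupp.mapDomain e β := by
    simpa using Finsupp.mapDomain_smul (f := e) (-1 : ℂ) β
  rw [← hneg]
  simp only [← Finsupp.mapDomain_comp]
  rfl

lemma pullback_pairMap {e : P → κ} (he : Function.Injective e) (x y : HalfSpace P) :
    pullback (1 / 4) (he.sumMap he) (pairMap P x y)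
      = pairMap κ (pullback (1 / 2) he x) (pullback (1 / 2) he y) := by
  have h : (ContinuousLinearMap.compL ℂ _ _ _
        (pullback (1 / 4) (he.sumMap he)).toContinuousLinearMap).comp (pairMap P)
      = (((pairMap κ).comp (pullback (1 / 2) he).toContinuousLinearMap).flip.comp
          (pullback (1 / 2) he).toContinuousLinearMap).flip := by
    refine clm_ext_expVec fun α => clm_ext_expVec fun β => ?_
    change pullback (1 / 4) (he.sumMap he) (pairMap P (expVec _ α) (expVec _ β))
      = pairMap κ (pullback (1 / 2) he (expVec _ α)) (pullback (1 / 2) he (expVec _ β))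
    rw [pairMap_expVec, pullback_expVec, pullback_expVec, pullback_expVec, pairMap_expVec,
      oddVec_mapDomain]
  exact congrArg (fun A : HalfSpace P →L[ℂ] HalfSpace P →L[ℂ] OddSpace κ => A x y) h

lemma conjIso_pullback (v : ℝ≥0) {e : P → κ} (he : Function.Injective e)
    (F : Lp ℂ 2 (gauss P v)) :
    conjIso _ (pullback v he F) = pullback v he (conjIso _ F) := by
  refine Lp.ext ?_
  filter_upwards [coeFn_pullback v he (conjIso _ F), coeFn_conjIso _ (pullback v he F),
    coeFn_pullback v he F,
    (measurePreserving_reindex v he).quasiMeasurePreserving.ae (coeFn_conjIso _ F)]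
    with q h1 h2 h3 h4
  rw [h1, h2, h3, h4]

lemma conjIso_expVec (v : ℝ≥0) (c : κ →₀ ℂ) : conjIso _ (expVec v c) = expVec v (conjVec c) := by
  refine Lp.ext ?_
  filter_upwards [coeFn_conjIso _ (expVec v c), coeFn_expVec v c, coeFn_expVec v (conjVec c)]
    with q h1 h2 h3
  rw [h1, h2, h3, conj_expFun]

end Pullback

section WignerWeyl

variable {ι : Type*} (J : Finset ι) {g h : (J → ℝ) → ℂ}

lemma memLp_div_refAmp (hg : Continuous g) (hgc : HasCompactSupport g) :
    MemLp (fun q => g q / (refAmp (1 / 2) q : ℂ)) 2 (gauss J (1 / 2)) := by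
  have hmp := measurePreserving_reindex (1 / 2) (Subtype.val_injective (p := fun k => k ∈ J))
  have hm : Measurable fun q : J → ℝ => g q / (refAmp (1 / 2) q : ℂ) :=
    hg.measurable.div (Complex.continuous_ofReal.comp (continuous_refAmp _)).measurable
  rw [← hmp.map_eq, memLp_map_measure_iff hm.aestronglyMeasurable hmp.measurable.aemeasurable]
  exact memLp_cylFun J g hg hgc

/-- A wavefunction of the components in `J`, as a vector of their Hilbert space. -/
def finVec (hg : Continuous g) (hgc : HasCompactSupport g) : HalfSpace J :=
  (memLp_div_refAmp J hg hgc).toLp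

lemma coeFn_finVec (hg : Continuous g) (hgc : HasCompactSupport g) :
    finVec J hg hgc =ᵐ[gauss J (1 / 2)] fun q => g q / (refAmp (1 / 2) q : ℂ) :=
  (memLp_div_refAmp J hg hgc).coeFn_toLp

lemma coeFn_cylVec (hg : Continuous g) (hgc : HasCompactSupport g) :
    cylVec J g hg hgc =ᵐ[gauss ι (1 / 2)] cylFun J g :=
  (memLp_cylFun J g hg hgc).coeFn_toLp

lemma cylVec_eq_pullback (hg : Continuous g) (hgc : HasCompactSupport g) :
    cylVec J g hg hgc
      = pullback (1 / 2) (Subtype.val_injective (p := fun k => k ∈ J)) (finVec J hg hgc) := by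
  refine Lp.ext ?_
  filter_upwards [coeFn_cylVec J hg hgc, coeFn_pullback (1 / 2)
    (Subtype.val_injective (p := fun k => k ∈ J)) (finVec J hg hgc),
    (measurePreserving_reindex (1 / 2)
      (Subtype.val_injective (p := fun k => k ∈ J))).quasiMeasurePreserving.ae
        (coeFn_finVec J hg hgc)] with q h1 h2 h3
  rw [h1, h2, h3, cylFun]

lemma inner_expVec_finVec (hg : Continuous g) (hgc : HasCompactSupport g) (α : J →₀ ℂ) :
    inner ℂ (expVec (1 / 2) α) (finVec J hg hgc) = ∫ x, g x * wave (1 / 2) (conjVec α) x := by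
  have h : (fun q => expFun (1 / 2) (conjVec α) q * finVec J hg hgc q) =ᵐ[gauss J (1 / 2)]
      fun q => expFun (1 / 2) (conjVec α) q * (g q / (refAmp (1 / 2) q : ℂ)) := by
    filter_upwards [coeFn_finVec J hg hgc] with q hq
    rw [hq]
  rw [inner_expVec_left, integral_congr_ae h, integral_gauss_eq (by norm_num)]
  refine integral_congr_ae (Filter.Eventually.of_forall fun q => ?_)
  have h0 : (refAmp (1 / 2) q : ℂ) ≠ 0 := by exact_mod_cast (refAmp_pos (by norm_num) q).ne'
  simp only [wave]
  field_simp

/-- The cross-Wigner function of `g` and `h` is the conjugate of the pairing of `g` with `conj h`: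
both sides have the same exponential moments. -/
lemma wignerDensity_ae_eq (hg : Continuous g) (hgc : HasCompactSupport g)
    (hh : Continuous h) (hhc : HasCompactSupport h) :
    wignerDensity J g h =ᵐ[gauss (J ⊕ J) (1 / 4)]
      fun q => conj (pairMap J (finVec J hg hgc) (conjIso _ (finVec J hh hhc)) q) := by
  set R := pairMap J (finVec J hg hgc) (conjIso _ (finVec J hh hhc)) with hR
  have hRi : Integrable (fun q => conj (R q)) (gauss (J ⊕ J) (1 / 4)) :=
    (((Lp.memLp (conjIso _ R)).integrable one_le_two)).congr (coeFn_conjIso _ R)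
  refine ae_eq_of_integral_expFun (integrable_wignerDensity J hg hgc hh hhc) hRi fun m => ?_
  obtain ⟨α, β, hαβ⟩ := exists_oddVec (imagVec m)
  have h1 : ∫ q, expFun (1 / 4) (oddVec α β) q * conj (R q) ∂(gauss (J ⊕ J) (1 / 4))
      = inner ℂ R (expVec (1 / 4) (oddVec α β)) := by
    rw [L2.inner_def]
    refine integral_congr_ae ?_
    filter_upwards [coeFn_expVec (1 / 4) (oddVec α β)] with q hq
    rw [hq, RCLike.inner_apply]
  rw [← hαβ, h1, ← pairMap_expVec, inner_pairMap, integral_expFun_mul_wignerDensity J hg hgc hh hhc]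
  congr 1
  · rw [← inner_conj_symm, inner_expVec_finVec, ← integral_conj]
    refine integral_congr_ae (Filter.Eventually.of_forall fun x => ?_)
    simp only [wave, map_mul, Complex.conj_ofReal, conj_expFun, conjVec_conjVec]
  · rw [← conjVec_conjVec β, ← conjIso_expVec, inner_conjIso, inner_expVec_finVec]

lemma crossWigner_ae_eq (hg : Continuous g) (hgc : HasCompactSupport g)
    (hh : Continuous h) (hhc : HasCompactSupport h) :
    (fun q : ι ⊕ ι → ℝ => crossWigner J g h (fun k => q (Sum.inl k)) (fun k => q (Sum.inr k)) /
        (refAmp (1 / 4) (fun k : J ⊕ J => q (Sum.map Subtype.val Subtype.val k)) : ℂ))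
      =ᵐ[gauss (ι ⊕ ι) (1 / 4)]
      fun q => conj (pairMap ι (cylVec J g hg hgc) (conjIso _ (cylVec J h hh hhc)) q) := by
  have he := Subtype.val_injective (p := fun k => k ∈ J)
  rw [cylVec_eq_pullback, cylVec_eq_pullback, conjIso_pullback, ← pullback_pairMap]
  filter_upwards [coeFn_pullback (1 / 4) (he.sumMap he)
      (pairMap J (finVec J hg hgc) (conjIso _ (finVec J hh hhc))),
    (measurePreserving_reindex (1 / 4) (he.sumMap he)).quasiMeasurePreserving.ae
      (wignerDensity_ae_eq J hg hgc hh hhc)] with q h1 h2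
  rw [h1, ← h2]
  rfl

/-- The operator on the half-horizon with the kernel `Ψ̃[B₁, B₂]` of a wavefunctional `Ψ`. Its matrix
elements are the pairings of `Ψ` with product kernels. -/
def halfOp (Ψ : OddSpace ι) : HalfSpace ι →L[ℂ] HalfSpace ι := opOf (pairMap ι) (conjIso _) Ψ

theorem isWeylTransform_halfOp (Ψ : OddSpace ι) :
    IsWeylTransform (reinterpret Ψ) (halfOp Ψ) := by
  intro J g h hg hgc hh hhc
  set R := pairMap ι (cylVec J g hg hgc) (conjIso _ (cylVec J h hh hhc)) with hR
  have hae : (fun q => inner ℂ (R q) (Ψ q)) =ᵐ[gauss (ι ⊕ ι) (1 / 4)] fun q => reinterpret Ψ q *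
      (crossWigner J g h (fun k => q (Sum.inl k)) (fun k => q (Sum.inr k)) /
        (refAmp (1 / 4) (fun k : J ⊕ J => q (Sum.map Subtype.val Subtype.val k)) : ℂ)) := by
    filter_upwards [crossWigner_ae_eq J hg hgc hh hhc] with q hq
    rw [hq, RCLike.inner_apply]
    rfl
  refine ⟨(L2.integrable_inner R Ψ).congr hae, ?_⟩
  rw [halfOp, inner_opOf, ← integral_congr_ae hae, ← L2.inner_def]

/-- A continuous cutoff, tending to `1` as `n → ∞`. -/
def cutoff (n : ℕ) (p : J → ℝ) : ℝ := max 0 (1 - ‖p‖ / (n + 1))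

lemma continuous_cutoff (n : ℕ) : Continuous (cutoff J n) := by
  unfold cutoff; fun_prop

lemma hasCompactSupport_cutoff (n : ℕ) : HasCompactSupport (cutoff J n) := by
  refine HasCompactSupport.intro (isCompact_closedBall 0 ((n : ℝ) + 1)) fun p hp => ?_
  rw [mem_closedBall_zero_iff, not_le] at hp
  refine max_eq_left (sub_nonpos.2 ?_)
  rw [le_div_iff₀ (by positivity), one_mul]
  exact hp.le

lemma abs_cutoff_le (n : ℕ) (p : J → ℝ) : |cutoff J n p| ≤ 1 := by
  rw [abs_of_nonneg (le_max_left _ _)]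
  exact max_le zero_le_one (sub_le_self _ (by positivity))

lemma tendsto_cutoff (p : J → ℝ) :
    Filter.Tendsto (fun n => cutoff J n p) Filter.atTop (nhds 1) := by
  have h := (tendsto_one_div_add_atTop_nhds_zero_nat (𝕜 := ℝ)).const_mul ‖p‖
  have h2 := (tendsto_const_nhds (x := (0 : ℝ)) (f := Filter.atTop (α := ℕ))).max
    ((tendsto_const_nhds (x := (1 : ℝ))).sub h)
  simp only [mul_zero, sub_zero, max_eq_right zero_le_one, mul_one_div] at h2
  exact h2

/-- The wavefunctions of the components in `J` that test the Wigner–Weyl transform are total among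
the functionals of these components: cut-off exponentials converge weakly to exponentials. -/
lemma inner_expVec_eq_zero_of_inner_cylVec {m : ι →₀ ℝ} (hm : (imagVec m).support ⊆ J)
    (x : HalfSpace ι)
    (hx : ∀ (g : (J → ℝ) → ℂ) (hg : Continuous g) (hgc : HasCompactSupport g),
      inner ℂ (cylVec J g hg hgc) x = 0) : inner ℂ (expVec (1 / 2) (imagVec m)) x = 0 := by
  have he := Subtype.val_injective (p := fun k => k ∈ J)
  set c : J →₀ ℂ := (imagVec m).comapDomain Subtype.val he.injOn with hc
  have hcm : c.mapDomain Subtype.val = imagVec m :=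
    Finsupp.mapDomain_comapDomain _ he _ fun k hk => ⟨⟨k, hm hk⟩, rfl⟩
  have hexp : ∀ q : ι → ℝ, expFun (1 / 2) (imagVec m) q = expFun (1 / 2) c fun k => q k := by
    intro q
    rw [← hcm, expFun_mapDomain _ he]
  have hg : ∀ n : ℕ, Continuous fun p => (cutoff J n p : ℂ) * wave (1 / 2) c p := fun n =>
    (Complex.continuous_ofReal.comp (continuous_cutoff J n)).mul (continuous_wave _ _)
  have hgc : ∀ n : ℕ, HasCompactSupport fun p => (cutoff J n p : ℂ) * wave (1 / 2) c p := fun n =>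
    ((hasCompactSupport_cutoff J n).comp_left (g := fun t : ℝ => (t : ℂ)) (by simp)).mul_right
  have hcyl : ∀ (n : ℕ) (q : ι → ℝ), cylFun J (fun p => (cutoff J n p : ℂ) * wave (1 / 2) c p) q
      = cutoff J n (fun k => q k) * expFun (1 / 2) (imagVec m) q := by
    intro n q
    have h0 : (refAmp (1 / 2) (fun k : J => q k) : ℂ) ≠ 0 := by
      exact_mod_cast (refAmp_pos (by norm_num) _).ne'
    rw [cylFun, wave, hexp]
    field_simp
  have hzero : ∀ n : ℕ, ∫ q, conj ((cutoff J n (fun k => q k) : ℂ) *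
      expFun (1 / 2) (imagVec m) q) * x q ∂(gauss ι (1 / 2)) = 0 := by
    intro n
    rw [← hx _ (hg n) (hgc n), L2.inner_def]
    refine integral_congr_ae ?_
    filter_upwards [coeFn_cylVec J (hg n) (hgc n)] with q hq
    rw [hq, hcyl, RCLike.inner_apply, mul_comm]
  have hmx : AEStronglyMeasurable x (gauss ι (1 / 2)) := (Lp.memLp x).1
  have hlim : Filter.Tendsto (fun n : ℕ => ∫ q, conj ((cutoff J n (fun k => q k) : ℂ) *
      expFun (1 / 2) (imagVec m) q) * x q ∂(gauss ι (1 / 2))) Filter.atTop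
      (nhds (∫ q, conj ((1 : ℝ) * expFun (1 / 2) (imagVec m) q) * x q ∂(gauss ι (1 / 2)))) := by
    refine tendsto_integral_of_dominated_convergence
      (fun q => ‖Complex.exp (-(((1 / 2 : ℝ≥0) : ℂ) / 2 * dot (imagVec m) (imagVec m)))‖ * ‖x q‖)
      (fun n => ?_) (((Lp.memLp x).integrable one_le_two).norm.const_mul _) (fun n => ?_) ?_
    · refine AEStronglyMeasurable.mul (Measurable.aestronglyMeasurable ?_) hmx
      have h1 : Measurable fun q : ι → ℝ => cutoff J n fun k => q k :=
        (continuous_cutoff J n).measurable.comp (by fun_prop)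
      have h2 := Complex.continuous_conj.measurable
      exact h2.comp ((Complex.measurable_ofReal.comp h1).mul (measurable_expFun _ _))
    · refine Filter.Eventually.of_forall fun q => ?_
      rw [norm_mul, RCLike.norm_conj, norm_mul, Complex.norm_real, Real.norm_eq_abs,
        expFun_imagVec, norm_mul, norm_exp_dot_imagVec, mul_one]
      gcongr
      exact mul_le_of_le_one_left (norm_nonneg _) (abs_cutoff_le J n _)
    · refine Filter.Eventually.of_forall fun q => ?_
      refine Filter.Tendsto.mul_const _ ?_
      refine (Complex.continuous_conj.tendsto _).comp (Filter.Tendsto.mul_const _ ?_)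
      exact (Complex.continuous_ofReal.tendsto _).comp (tendsto_cutoff J _)
  simp only [hzero] at hlim
  have h0 := tendsto_nhds_unique tendsto_const_nhds hlim
  rw [inner_expVec_left, h0]
  simp only [Complex.ofReal_one, one_mul, conj_expFun]

/-- A bounded operator is determined by its Wigner–Weyl transform. The two wavefunctions of a matrix
element have to depend on the same finite set of modes; the union of two sets of modes serves. -/
lemma IsWeylTransform.unique {F : PhaseFunctional ι} {S T : HalfSpace ι →L[ℂ] HalfSpace ι}
    (hS : IsWeylTransform F S) (hT : IsWeylTransform F T) : S = T := by
  classical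
  have h1 : ∀ (J : Finset ι) (g : (J → ℝ) → ℂ) (hg : Continuous g) (hgc : HasCompactSupport g)
      (h : (J → ℝ) → ℂ) (hh : Continuous h) (hhc : HasCompactSupport h),
      inner ℂ (cylVec J g hg hgc) ((S - T) (cylVec J h hh hhc)) = 0 := by
    intro J g hg hgc h hh hhc
    rw [sub_apply, inner_sub_right, (hS J g h hg hgc hh hhc).2, (hT J g h hg hgc hh hhc).2,
      sub_self]
  have h2 : ∀ m : ι →₀ ℝ,
      ContinuousLinearMap.adjoint (S - T) (expVec (1 / 2) (imagVec m)) = 0 := by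
    refine fun m => eq_zero_of_inner_expVec_imagVec fun m' => ?_
    refine inner_expVec_eq_zero_of_inner_cylVec ((imagVec m).support ∪ (imagVec m').support)
      Finset.subset_union_right _ fun h hh hhc => ?_
    rw [ContinuousLinearMap.adjoint_inner_right, ← inner_conj_symm,
      inner_expVec_eq_zero_of_inner_cylVec _ Finset.subset_union_left _
        fun g hg hgc => h1 _ g hg hgc h hh hhc, map_zero]
  refine sub_eq_zero.1 (ContinuousLinearMap.ext fun x => ?_)
  refine eq_zero_of_inner_expVec_imagVec fun m => ?_
  rw [← ContinuousLinearMap.adjoint_inner_left, h2, inner_zero_left]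

end WignerWeyl

/-! ### The reduced density operator -/

section ReducedDensity

variable {ι : Type*}

lemma weylOp_zero {κ : Type*} (v : ℝ≥0) : weylOp (κ := κ) v 0 = 1 := by
  refine clm_ext_expVec fun c => ?_
  rw [weylOp_expVec, add_zero, weylPhase, conjVec_zero, dot_zero_left, dot_zero_left]
  simp

lemma hasTrace_halfOp {U : HalfSpace ι →L[ℂ] HalfSpace ι} {V : OddSpace ι →L[ℂ] OddSpace ι}
    (hUV : ∀ x y, pairMap ι (U x) y = V (pairMap ι x y)) (Ψ : OddSpace ι) :
    HasTrace ((halfOp Ψ ∘L ContinuousLinearMap.adjoint (halfOp Ψ)) ∘L U) (inner ℂ Ψ (V Ψ)) :=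
  hasTrace_opOf inner_pairMap eq_zero_of_inner_pairMap inner_conjIso hUV Ψ

lemma halfOp_comp_adjoint_eq {Φ Ψ : OddSpace ι}
    (h : ∀ z : ι →₀ ℂ, inner ℂ Φ (weylOp (1 / 4) (oddVec z 0) Φ)
      = inner ℂ Ψ (weylOp (1 / 4) (oddVec z 0) Ψ)) :
    halfOp Φ ∘L ContinuousLinearMap.adjoint (halfOp Φ)
      = halfOp Ψ ∘L ContinuousLinearMap.adjoint (halfOp Ψ) := by
  have hmul : ∀ z w : ι →₀ ℂ, weylOp (1 / 4) (oddVec z 0) * weylOp (1 / 4) (oddVec w 0)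
      = Complex.exp ((1 / 4 : ℝ≥0) / 2 * (dot (conjVec (oddVec w 0)) (oddVec z 0)
          - dot (conjVec (oddVec z 0)) (oddVec w 0))) • weylOp (1 / 4) (oddVec (z + w) 0) := by
    intro z w
    rw [weylOp_mul, oddVec_add, add_zero]
  refine opOf_comp_adjoint_eq_of_inner_eq inner_pairMap eq_zero_of_inner_pairMap inner_conjIso
    (U := fun z : ι →₀ ℂ => weylOp (1 / 2) z) (V := fun z => weylOp (1 / 4) (oddVec z 0))
    pairMap_weylOp hmul ?_ (fun z => ?_) (fun z => adjoint_weylOp _ z)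
    (exists_eq_smul_one_of_commute_weylOp _) h
  · have h0 : oddVec (0 : ι →₀ ℂ) 0 = 0 := by ext (k | k) <;> simp [oddVec]
    rw [h0, weylOp_zero]
  · rw [adjoint_weylOp, oddVec_neg, neg_zero]

variable {X : Type*} [TopologicalSpace X] [MeasurableSpace X] [BorelSpace X]
  [SecondCountableTopology X] {μ : Measure X} [IsFiniteMeasureOnCompacts μ]
  {a b : ι → ℝ × X → ℝ}

lemma isReducedDensity_halfOp (hab : IsModeFamily μ a b) {Ψ : OddSpace ι} (hΨ : ‖Ψ‖ = 1) :
    IsReducedDensity μ a b Ψ (halfOp Ψ ∘L ContinuousLinearMap.adjoint (halfOp Ψ)) where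
  positive := ContinuousLinearMap.isPositive_self_comp_adjoint _
  trace_one := by
    have h := hasTrace_halfOp (U := 1) (V := 1) (fun _ _ => rfl) Ψ
    rwa [one_apply_eq_self, inner_self_eq_norm_sq_to_K, hΨ, ContinuousLinearMap.one_def,
      ContinuousLinearMap.comp_id, RCLike.ofReal_one, one_pow] at h
  expectation f hf := by
    obtain ⟨z, hz⟩ := exists_hasCoord_of_mem hab hf
    exact ⟨_, _, hz.isHorizonExp hab, hz.isHalfExp, hasTrace_halfOp (pairMap_weylOp z) Ψ⟩

/-- A purification of `ρ` on the horizon has the expectation values of `Ψ` in all Weyl operators of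
the half-horizon, hence the same reduction. -/
lemma IsReducedDensity.eq_halfOp (hab : IsModeFamily μ a b) {Ψ : OddSpace ι}
    {ρ : HalfSpace ι →L[ℂ] HalfSpace ι} (hρ : IsReducedDensity μ a b Ψ ρ) :
    ρ = halfOp Ψ ∘L ContinuousLinearMap.adjoint (halfOp Ψ) := by
  obtain ⟨s, e, -⟩ := exists_hilbertBasis ℂ (HalfSpace ι)
  obtain ⟨S, rfl, hS⟩ := exists_sqrt_of_hasTrace_one hρ.positive hρ.trace_one e
  obtain ⟨Φ, rfl⟩ := exists_opOf_eq inner_pairMap eq_zero_of_inner_pairMap inner_conjIso S e hS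
  refine halfOp_comp_adjoint_eq fun z => ?_
  obtain ⟨f, hf, hz⟩ := exists_mem_hasCoord hab z
  obtain ⟨V, U, hV, hU, htr⟩ := hρ.expectation f hf
  rw [hV.unique (hz.isHorizonExp hab), hU.unique hz.isHalfExp] at htr
  exact (hasTrace_halfOp (pairMap_weylOp z) Φ s e).unique (htr s e)

end ReducedDensity

end Horizon

end

theorem theorem1 {X : Type*} [TopologicalSpace X] [T2Space X] [LocallyCompactSpace X]
    [SecondCountableTopology X] [MeasurableSpace X] [BorelSpace X]
    (μ : MeasureTheory.Measure X) [MeasureTheory.IsFiniteMeasureOnCompacts μ]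
    {ι : Type*} (a b : ι → ℝ × X → ℝ) (hab : Horizon.IsModeFamily μ a b)
    (Ψ : Horizon.OddSpace ι) (hΨ : ‖Ψ‖ = 1) :
    ∃ T : Horizon.HalfSpace ι →L[ℂ] Horizon.HalfSpace ι,
      (∀ T' : Horizon.HalfSpace ι →L[ℂ] Horizon.HalfSpace ι,
        Horizon.IsWeylTransform (Horizon.reinterpret Ψ) T' ↔ T' = T) ∧
      ∀ ρ : Horizon.HalfSpace ι →L[ℂ] Horizon.HalfSpace ι,
        Horizon.IsReducedDensity μ a b Ψ ρ ↔ ρ = T ∘L ContinuousLinearMap.adjoint T := by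
  have hT := Horizon.isWeylTransform_halfOp Ψ
  refine ⟨Horizon.halfOp Ψ, fun T' => ⟨fun h => h.unique hT, ?_⟩,
    fun ρ => ⟨fun h => h.eq_halfOp hab, ?_⟩⟩
  · rintro rfl
    exact hT
  · rintro rfl
    exact Horizon.isReducedDensity_halfOp hab hΨ
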